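/- **Terms and contexts.** Let $\mathcal F=\bigcup_{n\ge 0}\mathcal F_n$ be a signature ($\mathcal F_n$ = symbols of arity $n$), $\mathcal X$ a set of variables, and $\mathcal T$ the set of terms over $\mathcal F,\mathcal X$. Positions are finite sequences of positive integers, $\varepsilon$ is the root, $t_{|i}$ is the $i$-th immediate subterm of $t$, and $ar(t)$ is the arity of the root symbol of $t$ ($0$ for a variable). The depth is $\delta(t)=1$ for variables and constants and $\delta(f(t_1,\dots,t_n))=1+\max_i\delta(t_i)$. A term $u$ matches $t$ if $\sigma(u)=t$ for some substitution $\sigma$. A context is a term with exactly one occurrence of a hole $\square$; $\tau\cdot\tau'$ is $\tau$ with $\square$ replaced by $\tau'$. **Position-based strategies.** A position-based strategy is either the failure $\emptyset$ or a list $\bigwedge_{k=1}^n @p_k.\tau_k$ ($n\ge1$) with contexts $\tau_k$ at pairwise distinct positions $p_k$; two lists that differ by a permutation are identified, so it is a finite partial map from positions to contexts, $\emptyset$ being the empty map. Unification: $E\sqcap E'=\emptyset$ if $E=\emptyset$ or $E'=\emptyset$; otherwise it is the union of $E$ and $E'$ in which, at a common position, $\tau$ of $E$ and $\tau'$ of $E'$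 are replaced by $\tau\cdot\tau'$. Combination: $E\mathbin{\hat\oplus}E'$ is $E\sqcap E'$ if both are $\neq\emptyset$, and otherwise the one that is $\ne\emptyset$ (and $\emptyset$ if there is none). **CE-strategies** are given by $$S,S'::=\emptyset\mid X\mid @\varepsilon.\tau\mid u;S\mid S\oplus S'\mid \mu X.S\mid \textstyle\bigwedge_{i\in I}@i.S_i\,[\wedge\,@\varepsilon.\tau]\mid \mathtt{Most}(S)\mid \mathtt{If}\ S\ \mathtt{Then}\ S'$$ with $X$ a fixed-point variable, $u\in\mathcal T$, $\tau$ a context, $I\subset\mathbb N$ finite, and the component $@\varepsilon.\tau$ of a list optional ($@\varepsilon.\tau$ alone is the case $I=\emptyset$; the empty list always fails). Strategies are taken up to renaming of bound variables. $S$ is closed if it has no free fixed-point variable, and monotone if in every sub-strategy $\mu X.S'$ each occurrence of $X$ in $S'$ lies below some $@i.$ ($i\neq\varepsilon$) or $\mathtt{Most}$. Put $\mu^0X.S=\emptyset$ and $\mu^{i+1}X.S=S(\mu^iX.S)$. **The map $\Psi$.** For closed $S$ and a term $t$, the position-based strategy $\Psi_t(S)$ is defined by: $\Psi_t(\emptyset)=\emptyset$;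 $\Psi_t(@\varepsilon.\tau)=@\varepsilon.\tau$; $\Psi_t(u;S)=\Psi_t(S)$ if $u$ matches $t$, else $\emptyset$; $\Psi_t(S\oplus S')=\Psi_t(S)$ if this is $\neq\emptyset$, else $\Psi_t(S')$; $\Psi_t(\mathtt{If}\ S'\ \mathtt{Then}\ S)=\Psi_t(S)$ if $\Psi_t(S')\ne\emptyset$, else $\emptyset$; $\Psi_t(\mu X.S)=\Psi_t(\mu^{\delta(t)}X.S)$; $\Psi_t(\bigwedge_{i\in I}@i.S_i\,[\wedge @\varepsilon.\tau])$ is the list of all $@ip.\tau'$ with $i\in I$, $1\le i\le ar(t)$ and $@p.\tau'$ in $\Psi_{t_{|i}}(S_i)$, together with $@\varepsilon.\tau$ if present; $\Psi_t(\mathtt{Most}(S))=\Psi_t(\bigwedge_{1\le i\le ar(t)}@i.S)$. **Unification and combination of CE-strategies.** Fix $N\in\mathbb N$. Pre-strategies are built like CE-strategies from CE-strategies and tuples $\langle S,R,M\rangle$, where $S,R$ are CE-strategies and the memory $M$ is a finite set of triples (strategy, strategy, variable); in $\mathtt{If}\ S\ \mathtt{Then}\ P$ the condition $S$ is a CE-strategy.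 A reduction step applies, to some tuple inside a pre-strategy, the first applicable rule of the following list; $\mathtt{If}\ S\&R\ \mathtt{Then}\ P$ means $\mathtt{If}\ S\ \mathtt{Then}\,(\mathtt{If}\ R\ \mathtt{Then}\ P)$. 1. $\langle\emptyset,R,M\rangle\to\emptyset$ and $\langle S,\emptyset,M\rangle\to\emptyset$. 2. $\langle @\varepsilon.\tau,@\varepsilon.\tau',M\rangle\to @\varepsilon.(\tau\cdot\tau')$. 3. $\langle u;S,R,M\rangle\to u;\langle S,R,M\rangle$; then $\langle S,u;R,M\rangle\to u;\langle S,R,M\rangle$. 4. $\langle @i.S,@i.R,M\rangle\to @i.\langle S,R,M\rangle$; then, for $S=\bigwedge_{i\in I}@i.S_i\,[\wedge @\varepsilon.\tau]$ and $R=\bigwedge_{j\in J}@j.R_j\,[\wedge @\varepsilon.\tau']$, $$\langle S,R,M\rangle\to\mathtt{If}\ S\&R\ \mathtt{Then}\ \bigwedge_{i\in I\cap J}@i.(\langle S_i,R_i,M\rangle\oplus S_i\oplus R_i)\wedge\bigwedge_{i\in I\setminus J}@i.S_i\wedge\bigwedge_{j\in J\setminus I}@j.R_j\,[\wedge @\varepsilon.(\tau\cdot\tau')],$$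 where $\tau\cdot\tau'$ is replaced by the only one present, or omitted, if not both are present. 5. $\langle S\oplus S',R,M\rangle\to\langle S,R,M\rangle\oplus\langle S',R,M\rangle$; then $\langle S,R\oplus R',M\rangle\to\langle S,R,M\rangle\oplus\langle S,R',M\rangle$. 6. $\langle\mathtt{If}\ S\ \mathtt{Then}\ S',R,M\rangle\to\mathtt{If}\ S\ \mathtt{Then}\ \langle S',R,M\rangle$; then $\langle S,\mathtt{If}\ R\ \mathtt{Then}\ R',M\rangle\to\mathtt{If}\ R\ \mathtt{Then}\ \langle S,R',M\rangle$. 7. $\langle\mathtt{Most}(S),\mathtt{Most}(R),M\rangle\to\mathtt{If}\ \mathtt{Most}(S)\&\mathtt{Most}(R)\ \mathtt{Then}\ \mathtt{Most}(\langle S,R,M\rangle\oplus S\oplus R)$; when one component is $\mathtt{Most}(S)$ and the other a list, $\mathtt{Most}(S)$ is replaced by $\bigwedge_{1\le i\le N}@i.S$. 8. If $\xi=\mu X.S$: $\langle\xi,R,M\rangle\to Z$ if $(\xi,R,Z)\in M$, and otherwise $\langle\xi,R,M\rangle\to\mu Z.\langle S(\xi),R,M\cup\{(\xi,R,Z)\}\rangle$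 with $Z$ fresh; then the symmetric rule for $\langle S,\xi,M\rangle$. $S\sqcap R$ is the normal form of $\langle S,R,\emptyset\rangle$, and the combination is $S\mathbin{\hat\oplus}R:=(S\sqcap R)\oplus S\oplus R$. **Theorem (Correction of the combination).** Let $S,R$ be closed monotone CE-strategies. Then the combination $S\mathbin{\hat\oplus}R$ is well defined, i.e. $\langle S,R,\emptyset\rangle$ has exactly one normal form, and it is a closed CE-strategy; and for every term $t$ whose function symbols all have arity at most $N$ (every term, if $N$ bounds the arities of $\mathcal F$), $$\Psi_t(S\mathbin{\hat\oplus}R)=\Psi_t(S)\mathbin{\hat\oplus}\Psi_t(R).$$ -/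

import Mathlib

universe u v w

namespace HCE

open FirstOrder

section Terms

variable {L : FirstOrder.Language.{u, v}} {X : Type w}

/-- Arity of the root symbol of a term (`0` for a variable). -/
def arity : L.Term X → ℕ
  | .var _ => 0
  | .func (l := n) _ _ => n

/-- The immediate subterm at position `i`; positions are numbered `1, …, arity t`.
The value is `none` when `i` is not a position of `t`. -/
def child : L.Term X → ℕ → Option (L.Term X)
  | .var _, _ => none
  | .func (l := n) _ ts, i => if h : 1 ≤ i ∧ i ≤ n then some (ts ⟨i - 1, by omega⟩) else none

/-- Depth of a term; variables and constants have depth `1`. -/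
def depth : L.Term X → ℕ
  | .var _ => 1
  | .func _ ts => 1 + Finset.univ.sup (fun i => depth (ts i))

/-- All function symbols occurring in the term have arity at most `N`. -/
def ArityLE (N : ℕ) : L.Term X → Prop
  | .var _ => True
  | .func (l := n) _ ts => n ≤ N ∧ ∀ i, ArityLE N (ts i)

/-- `u` matches `t`: some substitution (with finite domain) sends `u` to `t`. -/
def Matches (u t : L.Term X) : Prop :=
  ∃ σ : X → L.Term X, {x | σ x ≠ .var x}.Finite ∧ u.subst σ = t

end Terms

/-- Contexts: terms with exactly one occurrence of the hole. In `func f i c ts` the hole lies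
in the `i`-th argument `c`, and `ts` gives the other arguments. -/
inductive Ctx (L : FirstOrder.Language.{u, v}) (X : Type w) : Type (max u w)
  | hole : Ctx L X
  | func {n : ℕ} (f : L.Functions n) (i : Fin n) (c : Ctx L X)
      (ts : {j : Fin n // j ≠ i} → L.Term X) : Ctx L X

/-- The merge `τ · τ'`: replace the hole of `τ` by `τ'`. -/
def Ctx.merge {L : FirstOrder.Language.{u, v}} {X : Type w} : Ctx L X → Ctx L X → Ctx L X
  | .hole, τ' => τ'
  | .func f i c ts, τ' => .func f i (c.merge τ') ts

/-- Merge of two optional contexts inserted at the same place. -/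
def mergeOpt {L : FirstOrder.Language.{u, v}} {X : Type w} :
    Option (Ctx L X) → Option (Ctx L X) → Option (Ctx L X)
  | some τ, some τ' => some (τ.merge τ')
  | some τ, none => some τ
  | none, o => o

/-- Position-based strategies `@p₁.τ₁ ∧ ⋯ ∧ @pₙ.τₙ` with pairwise distinct positions, taken up
to a permutation: finite partial maps from positions to contexts. The failing
strategy is the empty map. -/
@[ext]
structure PosCE (L : FirstOrder.Language.{u, v}) (X : Type w) where
  ctxAt : List ℕ → Option (Ctx L X)
  finite_support : {p | ctxAt p ≠ none}.Finite

namespace PosCE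

variable {L : FirstOrder.Language.{u, v}} {X : Type w}

/-- The failing position-based strategy. -/
def fail : PosCE L X := ⟨fun _ => none, by simp⟩

/-- `⋀_{i ∈ I} @i.Eᵢ ∧ @ε.root`, where the failing `Eᵢ` disappear from the list. -/
def jumps (I : Finset ℕ) (E : ℕ → PosCE L X) (root : Option (Ctx L X)) : PosCE L X where
  ctxAt
    | [] => root
    | i :: q => if i ∈ I then (E i).ctxAt q else none
  finite_support := by
    refine ((Set.finite_singleton ([] : List ℕ)).union
      (I.finite_toSet.biUnion fun i _ => (E i).finite_support.image (List.cons i))).subset ?_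
    rintro (_ | ⟨i, q⟩) hp
    · simp
    · refine Or.inr (Set.mem_biUnion (x := i) ?_ ⟨q, ?_, rfl⟩)
      · by_contra h
        exact hp (if_neg h)
      · intro h
        apply hp
        by_cases hi : i ∈ I
        · exact (if_pos hi).trans h
        · exact if_neg hi

/-- Position-wise union, contexts at a common position being merged. -/
def mergeAll (E E' : PosCE L X) : PosCE L X where
  ctxAt p := mergeOpt (E.ctxAt p) (E'.ctxAt p)
  finite_support := by
    refine (E.finite_support.union E'.finite_support).subset fun p hp => ?_
    by_contra h
    simp only [Set.mem_union, Set.mem_ofPred_eq, not_or, not_not] at h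
    exact hp (by rw [h.1, h.2]; rfl)

open Classical in
/-- Unification of position-based strategies. -/
noncomputable def unify (E E' : PosCE L X) : PosCE L X :=
  if E = fail ∨ E' = fail then fail else E.mergeAll E'

open Classical in
/-- Combination of position-based strategies. -/
noncomputable def combine (E E' : PosCE L X) : PosCE L X :=
  if E ≠ fail ∧ E' ≠ fail then E.unify E'
  else if E ≠ fail then E
  else if E' ≠ fail then E'
  else fail

end PosCE

/-- CE-strategies. Fixed-point variables are de Bruijn indices. `jumps I S root` is the list
`⋀_{i ∈ I} @i.Sᵢ ∧ @ε.root`, the last component being absent when `root = none`. -/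
inductive CE (L : FirstOrder.Language.{u, v}) (X : Type w) : Type (max u w)
  | fail : CE L X
  | var (k : ℕ) : CE L X
  | pattern (u : L.Term X) (S : CE L X) : CE L X
  | choice (S S' : CE L X) : CE L X
  | mu (S : CE L X) : CE L X
  | jumps (I : Finset ℕ) (S : {i : ℕ // i ∈ I} → CE L X) (root : Option (Ctx L X)) : CE L X
  | most (S : CE L X) : CE L X
  | ifThen (S S' : CE L X) : CE L X

namespace CE

variable {L : FirstOrder.Language.{u, v}} {X : Type w}

/-- The insertion `@ε.τ`. -/
def insert (τ : Ctx L X) : CE L X := jumps ∅ (fun _ => fail) (some τ)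

/-- All free variables have index less than `k`. -/
def ClosedAt : ℕ → CE L X → Prop
  | _, fail => True
  | k, var n => n < k
  | k, pattern _ S => S.ClosedAt k
  | k, choice S S' => S.ClosedAt k ∧ S'.ClosedAt k
  | k, mu S => S.ClosedAt (k + 1)
  | k, jumps _ S _ => ∀ i, (S i).ClosedAt k
  | k, most S => S.ClosedAt k
  | k, ifThen S S' => S.ClosedAt k ∧ S'.ClosedAt k

/-- The strategy has no free fixed-point variable. -/
def Closed (S : CE L X) : Prop := S.ClosedAt 0

/-- Every occurrence of the variable `k` lies below a jump `@i.` or below `Most`. -/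
def Guarded : ℕ → CE L X → Prop
  | _, fail => True
  | k, var n => n ≠ k
  | k, pattern _ S => S.Guarded k
  | k, choice S S' => S.Guarded k ∧ S'.Guarded k
  | k, mu S => S.Guarded (k + 1)
  | _, jumps _ _ _ => True
  | _, most _ => True
  | k, ifThen S S' => S.Guarded k ∧ S'.Guarded k

/-- In each fixed point `μX.S`, every occurrence of `X` in `S` is below a jump or `Most`. -/
def IsMonotone : CE L X → Prop
  | fail => True
  | var _ => True
  | pattern _ S => S.IsMonotone
  | choice S S' => S.IsMonotone ∧ S'.IsMonotone
  | mu S => S.Guarded 0 ∧ S.IsMonotone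
  | jumps _ S _ => ∀ i, (S i).IsMonotone
  | most S => S.IsMonotone
  | ifThen S S' => S.IsMonotone ∧ S'.IsMonotone

/-- `S.subst R k` substitutes the closed strategy `R` for the variable `k` in `S`. -/
def subst : CE L X → CE L X → ℕ → CE L X
  | fail, _, _ => fail
  | var n, R, k => if n = k then R else if k < n then var (n - 1) else var n
  | pattern u S, R, k => pattern u (S.subst R k)
  | choice S S', R, k => choice (S.subst R k) (S'.subst R k)
  | mu S, R, k => mu (S.subst R (k + 1))
  | jumps I S root, R, k => jumps I (fun i => (S i).subst R k) root
  | most S, R, k => most (S.subst R k)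
  | ifThen S S', R, k => ifThen (S.subst R k) (S'.subst R k)

/-- `S(R)`, where the fixed-point variable bound by the enclosing `μ` has index `0`. -/
def apply (S R : CE L X) : CE L X := S.subst R 0

/-- The iterates `μ⁰X.S = ∅` and `μⁱ⁺¹X.S = S(μⁱX.S)`. -/
def iter (S : CE L X) : ℕ → CE L X
  | 0 => fail
  | i + 1 => S.apply (S.iter i)

/-- Extension of an environment at index `0`. -/
def extend {α : Type*} (F : α) (ρ : ℕ → α) : ℕ → α
  | 0 => F
  | n + 1 => ρ n

open Classical in
/-- The translation of a strategy with free variables interpreted by `ρ`. The clause for `mu`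
iterates the interpretation of the body `depth t` times from failure; that this is the
translation of the syntactic iterate is `Psi_mu` below. -/
noncomputable def psi :
    CE L X → (ℕ → L.Term X → PosCE L X) → L.Term X → PosCE L X
  | fail, _, _ => PosCE.fail
  | var n, ρ, t => ρ n t
  | pattern u S, ρ, t => if Matches u t then S.psi ρ t else PosCE.fail
  | choice S S', ρ, t => if S.psi ρ t ≠ PosCE.fail then S.psi ρ t else S'.psi ρ t
  | mu S, ρ, t => (fun F => S.psi (extend F ρ))^[depth t] (fun _ => PosCE.fail) t
  | jumps I S root, ρ, t =>
      PosCE.jumps I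
        (fun i => if h : i ∈ I then ((child t i).map ((S ⟨i, h⟩).psi ρ)).getD PosCE.fail
          else PosCE.fail) root
  | most S, ρ, t =>
      PosCE.jumps (Finset.Icc 1 (arity t))
        (fun i => ((child t i).map (S.psi ρ)).getD PosCE.fail) none
  | ifThen S S', ρ, t => if S.psi ρ t ≠ PosCE.fail then S'.psi ρ t else PosCE.fail

/-- The position-based strategy `Ψ_t(S)` of a closed strategy `S` at a term `t`. -/
noncomputable def Psi (t : L.Term X) (S : CE L X) : PosCE L X :=
  S.psi (fun _ _ => PosCE.fail) t

theorem psi_congr (S : CE L X) : ∀ (k : ℕ) (ρ ρ' : ℕ → L.Term X → PosCE L X),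
    S.ClosedAt k → (∀ n, n < k → ρ n = ρ' n) → S.psi ρ = S.psi ρ' := by
  induction S with
  | fail => intros; funext t; simp [psi]
  | var n => intro k ρ ρ' h e; funext t; simp [psi, e n h]
  | pattern u S ih => intro k ρ ρ' h e; funext t; simp [psi, ih k ρ ρ' h e]
  | choice S S' ih ih' =>
      intro k ρ ρ' h e; funext t; simp only [psi]; rw [ih k ρ ρ' h.1 e, ih' k ρ ρ' h.2 e]
  | mu S ih =>
      intro k ρ ρ' h e
      have : ∀ F, S.psi (extend F ρ) = S.psi (extend F ρ') := fun F =>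
        ih (k + 1) _ _ h (by rintro (_ | n) hn; · rfl
                             · exact e n (by omega))
      funext t; simp [psi, this]
  | jumps I S root ih =>
      intro k ρ ρ' h e; funext t; simp [psi, fun i => ih i k ρ ρ' (h i) e]
  | most S ih => intro k ρ ρ' h e; funext t; simp [psi, ih k ρ ρ' h e]
  | ifThen S S' ih ih' =>
      intro k ρ ρ' h e; funext t; simp only [psi]; rw [ih k ρ ρ' h.1 e, ih' k ρ ρ' h.2 e]

theorem psi_subst (R : CE L X) (hR : R.Closed) (S : CE L X) :
    ∀ (k : ℕ) (ρ ρ' : ℕ → L.Term X → PosCE L X),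
    (∀ n, n < k → ρ' n = ρ n) → ρ' k = R.psi ρ → (∀ n, k ≤ n → ρ' (n + 1) = ρ n) →
    (S.subst R k).psi ρ = S.psi ρ' := by
  induction S with
  | fail => intros; funext t; simp [psi, subst]
  | var n =>
      intro k ρ ρ' h1 h2 h3
      funext t
      rcases lt_trichotomy n k with h | h | h
      · simp [psi, subst, h.ne, h.not_gt, h1 n h]
      · subst h; simp [psi, subst, h2]
      · obtain ⟨m, rfl⟩ : ∃ m, n = m + 1 := ⟨n - 1, by omega⟩
        simp [psi, subst, h.ne', h, h3 m (by omega)]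
  | pattern u S ih => intro k ρ ρ' h1 h2 h3; funext t; simp [psi, subst, ih k ρ ρ' h1 h2 h3]
  | choice S S' ih ih' =>
      intro k ρ ρ' h1 h2 h3; funext t
      simp only [psi, subst]; rw [ih k ρ ρ' h1 h2 h3, ih' k ρ ρ' h1 h2 h3]
  | mu S ih =>
      intro k ρ ρ' h1 h2 h3
      have : ∀ F, (S.subst R (k + 1)).psi (extend F ρ) = S.psi (extend F ρ') := fun F => by
        refine ih (k + 1) _ _ ?_ ?_ ?_
        · rintro (_ | n) hn
          · rfl
          · exact h1 n (by omega)
        · exact h2.trans (psi_congr R 0 _ _ hR (by intro n hn; omega))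
        · rintro (_ | n) hn
          · omega
          · exact h3 n (by omega)
      funext t; simp [psi, subst, this]
  | jumps I S root ih =>
      intro k ρ ρ' h1 h2 h3; funext t; simp [psi, subst, fun i => ih i k ρ ρ' h1 h2 h3]
  | most S ih => intro k ρ ρ' h1 h2 h3; funext t; simp [psi, subst, ih k ρ ρ' h1 h2 h3]
  | ifThen S S' ih ih' =>
      intro k ρ ρ' h1 h2 h3; funext t
      simp only [psi, subst]; rw [ih k ρ ρ' h1 h2 h3, ih' k ρ ρ' h1 h2 h3]

theorem closedAt_mono (S : CE L X) : ∀ (k m : ℕ), k ≤ m → S.ClosedAt k → S.ClosedAt m := by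
  induction S with
  | fail => intros; trivial
  | var n => intro k m h h'; exact lt_of_lt_of_le h' h
  | pattern u S ih => intro k m h h'; exact ih k m h h'
  | choice S S' ih ih' => intro k m h h'; exact ⟨ih k m h h'.1, ih' k m h h'.2⟩
  | mu S ih => intro k m h h'; exact ih (k + 1) (m + 1) (by omega) h'
  | jumps I S root ih => intro k m h h' i; exact ih i k m h (h' i)
  | most S ih => intro k m h h'; exact ih k m h h'
  | ifThen S S' ih ih' => intro k m h h'; exact ⟨ih k m h h'.1, ih' k m h h'.2⟩

theorem closedAt_subst (R : CE L X) (hR : R.Closed) (S : CE L X) :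
    ∀ k, S.ClosedAt (k + 1) → (S.subst R k).ClosedAt k := by
  induction S with
  | fail => intros; trivial
  | var n =>
      intro k h
      have h : n < k + 1 := h
      by_cases hn : n = k
      · simpa [subst, hn] using closedAt_mono R 0 k (by omega) hR
      · have : n < k := by omega
        simp [subst, hn, this.not_gt, ClosedAt, this]
  | pattern u S ih => intro k h; exact ih k h
  | choice S S' ih ih' => intro k h; exact ⟨ih k h.1, ih' k h.2⟩
  | mu S ih => intro k h; exact ih (k + 1) h
  | jumps I S root ih => intro k h i; exact ih i k (h i)
  | most S ih => intro k h; exact ih k h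
  | ifThen S S' ih ih' => intro k h; exact ⟨ih k h.1, ih' k h.2⟩

theorem closed_iter (S : CE L X) (hS : (mu S).Closed) : ∀ n, (S.iter n).Closed
  | 0 => trivial
  | n + 1 => closedAt_subst _ (closed_iter S hS n) S 0 hS

/-- `Ψ_t(μX.S) = Ψ_t(μ^{depth t}X.S)`. -/
theorem Psi_mu (S : CE L X) (hS : (mu S).Closed) (t : L.Term X) :
    Psi t (mu S) = Psi t (S.iter (depth t)) := by
  have key : ∀ n, (S.iter n).psi (fun _ _ => PosCE.fail) =
      (fun F => S.psi (extend F fun _ _ => PosCE.fail))^[n] (fun _ => PosCE.fail) := by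
    intro n
    induction n with
    | zero => funext t; simp [iter, psi]
    | succ n ih =>
        rw [Function.iterate_succ_apply', ← ih]
        exact psi_subst _ (closed_iter S hS n) S 0 _ _ (by intro n hn; omega) rfl
          (fun _ _ => rfl)
  show (mu S).psi _ t = _
  rw [Psi, key]
  simp [psi]

end CE

/-- Pre-strategies: strategies that may contain tuples `⟨S, R, M⟩`. A memory `M` lists, most
recent first, the pairs recorded on the path from the root, one for each `μ` created on that
path, so that the variable recorded with an entry is its index in the list. -/
inductive PreCE (L : FirstOrder.Language.{u, v}) (X : Type w) : Type (max u w)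
  | tuple (S R : CE L X) (M : List (CE L X × CE L X)) : PreCE L X
  | fail : PreCE L X
  | var (k : ℕ) : PreCE L X
  | pattern (u : L.Term X) (P : PreCE L X) : PreCE L X
  | choice (P P' : PreCE L X) : PreCE L X
  | mu (P : PreCE L X) : PreCE L X
  | jumps (I : Finset ℕ) (P : {i : ℕ // i ∈ I} → PreCE L X) (root : Option (Ctx L X)) : PreCE L X
  | most (P : PreCE L X) : PreCE L X
  | ifThen (S : CE L X) (P : PreCE L X) : PreCE L X

variable {L : FirstOrder.Language.{u, v}} {X : Type w}

/-- Strategies are pre-strategies without tuples. -/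
def CE.toPre : CE L X → PreCE L X
  | .fail => .fail
  | .var k => .var k
  | .pattern u S => .pattern u S.toPre
  | .choice S S' => .choice S.toPre S'.toPre
  | .mu S => .mu S.toPre
  | .jumps I S root => .jumps I (fun i => (S i).toPre) root
  | .most S => .most S.toPre
  | .ifThen S S' => .ifThen S S'.toPre

namespace PreCE

/-- The rules for two lists. In order: two insertions at the root; two single jumps to
the same position; the general case. -/
def listRule (I : Finset ℕ) (S : {i : ℕ // i ∈ I} → CE L X) (r : Option (Ctx L X))
    (J : Finset ℕ) (R : {i : ℕ // i ∈ J} → CE L X) (r' : Option (Ctx L X))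
    (M : List (CE L X × CE L X)) : PreCE L X :=
  if I = ∅ ∧ J = ∅ ∧ r.isSome ∧ r'.isSome then
    jumps ∅ (fun _ => fail) (mergeOpt r r')
  else if h : I = J ∧ I.card = 1 ∧ r.isNone ∧ r'.isNone then
    jumps I (fun i => tuple (S i) (R ⟨i.1, h.1 ▸ i.2⟩) M) none
  else
    ifThen (.jumps I S r) (ifThen (.jumps J R r')
      (jumps (I ∪ J)
        (fun i =>
          if hI : i.1 ∈ I then
            if hJ : i.1 ∈ J then
              choice (tuple (S ⟨i.1, hI⟩) (R ⟨i.1, hJ⟩) M)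
                (choice (S ⟨i.1, hI⟩).toPre (R ⟨i.1, hJ⟩).toPre)
            else (S ⟨i.1, hI⟩).toPre
          else (R ⟨i.1, (Finset.mem_union.1 i.2).resolve_left hI⟩).toPre)
        (mergeOpt r r')))

/-- `Most(S)` written as the list of jumps to the positions `1, …, N`. -/
def mostList (N : ℕ) (S : CE L X) : CE L X := .jumps (Finset.Icc 1 N) (fun _ => S) none

open Classical in
/-- The rules rewriting a tuple, in decreasing order of priority. -/
noncomputable def rule (N : ℕ) : CE L X → CE L X → List (CE L X × CE L X) → Option (PreCE L X)
  | .fail, _, _ => some fail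
  | _, .fail, _ => some fail
  | .pattern u S, R, M => some (pattern u (tuple S R M))
  | S, .pattern u R, M => some (pattern u (tuple S R M))
  | .jumps I S r, .jumps J R r', M => some (listRule I S r J R r' M)
  | .choice S S', R, M => some (choice (tuple S R M) (tuple S' R M))
  | S, .choice R R', M => some (choice (tuple S R M) (tuple S R' M))
  | .ifThen S S', R, M => some (ifThen S (tuple S' R M))
  | S, .ifThen R R', M => some (ifThen R (tuple S R' M))
  | .most S, .most R, M =>
      some (ifThen (.most S) (ifThen (.most R)
        (most (choice (tuple S R M) (choice S.toPre R.toPre)))))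
  | .most S, .jumps J R r', M => some (tuple (mostList N S) (.jumps J R r') M)
  | .jumps I S r, .most R, M => some (tuple (.jumps I S r) (mostList N R) M)
  | .mu S, R, M =>
      if (.mu S, R) ∈ M then some (var (M.idxOf (.mu S, R)))
      else some (mu (tuple (S.apply (.mu S)) R ((.mu S, R) :: M)))
  | S, .mu R, M =>
      if (S, .mu R) ∈ M then some (var (M.idxOf (S, .mu R)))
      else some (mu (tuple S (R.apply (.mu R)) ((S, .mu R) :: M)))
  | _, _, _ => none

/-- One step of the unification reduction system. -/
inductive Step (N : ℕ) : PreCE L X → PreCE L X → Prop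
  | tuple {S R M P} : rule N S R M = some P → Step N (tuple S R M) P
  | pattern {u P P'} : Step N P P' → Step N (pattern u P) (pattern u P')
  | choice_left {P P' Q} : Step N P P' → Step N (choice P Q) (choice P' Q)
  | choice_right {P Q Q'} : Step N Q Q' → Step N (choice P Q) (choice P Q')
  | mu {P P'} : Step N P P' → Step N (mu P) (mu P')
  | jumps {I P root} (i : {i : ℕ // i ∈ I}) {P'} : Step N (P i) P' →
      Step N (jumps I P root) (jumps I (Function.update P i P') root)
  | most {P P'} : Step N P P' → Step N (most P) (most P')
  | ifThen {S P P'} : Step N P P' → Step N (ifThen S P) (ifThen S P')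

/-- `Q` is a normal form of `P`. -/
def IsNormalForm (N : ℕ) (P Q : PreCE L X) : Prop :=
  Relation.ReflTransGen (Step N) P Q ∧ ∀ Q', ¬ Step N Q Q'

end PreCE

namespace CE

open Classical in
/-- The unification `S ⊓ R`: the strategy that is the normal form of `⟨S, R, ∅⟩`
(`fail` if there were none). -/
noncomputable def unify (N : ℕ) (S R : CE L X) : CE L X :=
  if h : ∃ U : CE L X, PreCE.IsNormalForm N (.tuple S R []) U.toPre then h.choose else fail

/-- The combination `(S ⊓ R) ⊕ S ⊕ R`. -/
noncomputable def combine (N : ℕ) (S R : CE L X) : CE L X :=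
  choice (unify N S R) (choice S R)

end CE

end HCE

/-! At each tuple the rewriting is given by the function `rule`, so a reduction is free only in the
order in which it treats the tuples. Hence a big-step evaluation `Eval` suffices. Steps preserve the
value, and the value is reachable and irreducible, so it is the unique normal form
(`Eval.isNormalForm_iff`).

Evaluation terminates because the components of the tuples stay in finite sets of derivatives
(`exists_finset_deriv_closed`). Only finitely many pairs can therefore enter the memory, and while
the memory is unchanged the components get smaller. `exists_isUnifier_of_mem` is the resulting
lexicographic induction.

The same induction carries the semantics (`IsUnifier`): when each recorded variable is interpreted
as the unification of its pair, the value of a tuple translates to the unification of the two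
translations. The delicate case is `μ`. Unfolding shows that this unification is a fixed point of
the new body. If the new variable is guarded in that body, the value at a term depends only on
values at terms of smaller depth, so the fixed point is unique and is reached after `depth t`
iterations (`psi_mu_eq_of_fixed`). Guardedness is read off from `headSize`: it drops at the
unfolding that records a pair and does not grow before the next jump or `Most`, so the same pair
cannot recur unguarded.

Below a jump a failing branch is simply dropped. The operation needed there is thus a union in which
failure is neutral, and `(S ⊓ R) ⊕ S ⊕ R` computes it (`choice_unify_eq_mergeAll`). At the root the
same computation yields the theorem. -/

namespace HCE

open FirstOrder

variable {L : FirstOrder.Language.{u, v}} {X : Type w}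

/-! ### Depth, children and arities of terms. -/

section Terms

theorem depth_pos (t : L.Term X) : 0 < depth t := by
  cases t <;> simp [depth]

theorem depth_child_lt {t c : L.Term X} {i : ℕ} (h : child t i = some c) :
    depth c < depth t := by
  cases t with
  | var _ => simp [child] at h
  | func f ts =>
      simp only [child] at h
      split at h
      · cases h
        rw [depth, Nat.lt_one_add_iff]
        exact Finset.le_sup (f := fun i => depth (ts i)) (Finset.mem_univ _)
      · cases h

theorem ArityLE.child {N : ℕ} {t c : L.Term X} {i : ℕ} (ht : ArityLE N t)
    (h : child t i = some c) : ArityLE N c := by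
  cases t with
  | var _ => simp [HCE.child] at h
  | func f ts =>
      simp only [HCE.child] at h
      split at h
      · cases h
        exact ht.2 _
      · cases h

theorem ArityLE.arity_le {N : ℕ} {t : L.Term X} (ht : ArityLE N t) : arity t ≤ N := by
  cases t with
  | var _ => exact Nat.zero_le _
  | func f ts => exact ht.1

theorem child_eq_none {t : L.Term X} {i : ℕ} (h : i ∉ Finset.Icc 1 (arity t)) :
    child t i = none := by
  cases t with
  | var _ => rfl
  | func f ts => exact dif_neg (by simpa [arity] using h)

end Terms

/-! ### Algebra of position-based strategies. -/

namespace PosCE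

theorem mergeOpt_none_right (o : Option (Ctx L X)) : mergeOpt o none = o := by
  cases o <;> rfl

theorem mergeOpt_eq_none {o o' : Option (Ctx L X)} :
    mergeOpt o o' = none ↔ o = none ∧ o' = none := by
  cases o <;> cases o' <;> simp [mergeOpt]

@[simp]
theorem fail_ctxAt (p : List ℕ) : (fail : PosCE L X).ctxAt p = none := rfl

theorem eq_fail_iff {E : PosCE L X} : E = fail ↔ ∀ p, E.ctxAt p = none :=
  ⟨fun h _ => h ▸ rfl, fun h => PosCE.ext (funext h)⟩

theorem mergeAll_fail (E : PosCE L X) : E.mergeAll fail = E :=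
  PosCE.ext (funext fun _ => mergeOpt_none_right _)

theorem fail_mergeAll (E : PosCE L X) : fail.mergeAll E = E := rfl

theorem mergeAll_eq_fail {E E' : PosCE L X} : E.mergeAll E' = fail ↔ E = fail ∧ E' = fail := by
  simp only [eq_fail_iff, mergeAll, mergeOpt_eq_none, forall_and]

@[simp]
theorem fail_unify (E : PosCE L X) : fail.unify E = fail := if_pos (.inl rfl)

@[simp]
theorem unify_fail (E : PosCE L X) : E.unify fail = fail := if_pos (.inr rfl)

theorem unify_of_ne {E E' : PosCE L X} (h : E ≠ fail) (h' : E' ≠ fail) :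
    E.unify E' = E.mergeAll E' := if_neg (not_or.2 ⟨h, h'⟩)

theorem unify_eq_fail {E E' : PosCE L X} : E.unify E' = fail ↔ E = fail ∨ E' = fail := by
  by_cases h : E = fail
  · simp [h]
  by_cases h' : E' = fail
  · simp [h']
  simp [unify_of_ne h h', mergeAll_eq_fail, h, h']

open Classical in
-- Failure absorbs in `unify` but is neutral in `mergeAll`; the two fallback branches repair exactly
-- this difference. This form serves below jumps, where unions are taken position by position.
theorem choice_unify_eq_mergeAll (E E' : PosCE L X) :
    (if E.unify E' ≠ fail then E.unify E' else if E ≠ fail then E else E') = E.mergeAll E' := by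
  by_cases h : E = fail
  · simp [h, fail_mergeAll]
  by_cases h' : E' = fail
  · simp [h, h', mergeAll_fail]
  simp [unify_of_ne h h', mergeAll_eq_fail, h]

open Classical in
theorem choice_unify_eq_combine (E E' : PosCE L X) :
    (if E.unify E' ≠ fail then E.unify E' else if E ≠ fail then E else E') = E.combine E' := by
  by_cases h : E = fail <;> by_cases h' : E' = fail <;> simp [combine, h, h', unify_eq_fail]

theorem jumps_congr {I : Finset ℕ} {E E' : ℕ → PosCE L X} {r : Option (Ctx L X)}
    (h : ∀ i ∈ I, E i = E' i) : jumps I E r = jumps I E' r := by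
  ext1
  funext p
  rcases p with _ | ⟨i, q⟩
  · rfl
  · by_cases hi : i ∈ I
    · simp [jumps, hi, h i hi]
    · simp [jumps, hi]

theorem jumps_eq_fail {I : Finset ℕ} {E : ℕ → PosCE L X} {r : Option (Ctx L X)} :
    jumps I E r = fail ↔ r = none ∧ ∀ i ∈ I, E i = fail := by
  constructor
  · intro h
    refine ⟨eq_fail_iff.1 h [], fun i hi => eq_fail_iff.2 fun q => ?_⟩
    simpa [jumps, hi] using eq_fail_iff.1 h (i :: q)
  · rintro ⟨rfl, h⟩
    rw [jumps_congr h, eq_fail_iff]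
    rintro (_ | ⟨i, q⟩)
    · rfl
    · simp [jumps]

/-- The hypotheses make both families total by failure, so a position in only one of the index sets
needs no separate treatment. -/
theorem mergeAll_jumps {I J : Finset ℕ} {E E' : ℕ → PosCE L X} {r r' : Option (Ctx L X)}
    (hE : ∀ i ∉ I, E i = fail) (hE' : ∀ i ∉ J, E' i = fail) :
    (jumps I E r).mergeAll (jumps J E' r') =
      jumps (I ∪ J) (fun i => (E i).mergeAll (E' i)) (mergeOpt r r') := by
  ext1
  funext p
  rcases p with _ | ⟨i, q⟩
  · rfl
  · by_cases hi : i ∈ I <;> by_cases hj : i ∈ J <;>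
      simp [jumps, mergeAll, hi, hj, hE, hE', mergeOpt]

/-- With one jump and no root insertion, the list fails exactly when its component does. Failure
therefore absorbs on both sides, and plain unification can pass below the jump. -/
theorem unify_jumps_singleton (i : ℕ) (E E' : ℕ → PosCE L X) :
    (jumps {i} E none).unify (jumps {i} E' none) =
      jumps {i} (fun i => (E i).unify (E' i)) none := by
  by_cases h : E i = fail
  · rw [jumps_eq_fail.2 (by simpa using h), fail_unify, eq_comm, jumps_eq_fail]
    simp [h]
  by_cases h' : E' i = fail
  · rw [(jumps_eq_fail (E := E')).2 (by simpa using h'), unify_fail, eq_comm, jumps_eq_fail]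
    simp [h']
  rw [unify_of_ne (by simpa [jumps_eq_fail] using h) (by simpa [jumps_eq_fail] using h')]
  ext1
  funext p
  rcases p with _ | ⟨j, q⟩
  · rfl
  · by_cases hj : j = i
    · subst hj
      simp [jumps, mergeAll, unify_of_ne h h']
    · simp [jumps, mergeAll, hj, mergeOpt]

end PosCE

namespace CE

/-! ### Guardedness and monotonicity -/

theorem guarded_of_closedAt (S : CE L X) :
    ∀ k m : ℕ, k ≤ m → S.ClosedAt k → S.Guarded m := by
  induction S with
  | fail => intros; trivial
  | var n => intro k m h h'; exact (lt_of_lt_of_le h' h).ne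
  | pattern u S ih => intro k m h h'; exact ih k m h h'
  | choice S S' ih ih' => intro k m h h'; exact ⟨ih k m h h'.1, ih' k m h h'.2⟩
  | mu S ih => intro k m h h'; exact ih (k + 1) (m + 1) (by omega) h'
  | jumps I S root ih => intros; trivial
  | most S ih => intros; trivial
  | ifThen S S' ih ih' => intro k m h h'; exact ⟨ih k m h h'.1, ih' k m h h'.2⟩

theorem Closed.guarded {S : CE L X} (h : S.Closed) (k : ℕ) : S.Guarded k :=
  guarded_of_closedAt S 0 k (Nat.zero_le k) h

theorem Closed.closedAt {S : CE L X} (h : S.Closed) (k : ℕ) : S.ClosedAt k :=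
  closedAt_mono S 0 k (Nat.zero_le k) h

theorem subst_of_closedAt (R S : CE L X) : ∀ k, S.ClosedAt k → S.subst R k = S := by
  induction S with
  | fail => intros; rfl
  | var n =>
      intro k h
      have h : n < k := h
      simp [subst, h.ne, h.not_gt]
  | pattern u S ih => intro k h; simp [subst, ih k h]
  | choice S S' ih ih' => intro k h; simp [subst, ih k h.1, ih' k h.2]
  | mu S ih => intro k h; simp [subst, ih (k + 1) h]
  | jumps I S root ih => intro k h; simp [subst, fun i => ih i k (h i)]
  | most S ih => intro k h; simp [subst, ih k h]
  | ifThen S S' ih ih' => intro k h; simp [subst, ih k h.1, ih' k h.2]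

theorem Guarded.subst {R : CE L X} (hR : R.Closed) (S : CE L X) :
    ∀ k m : ℕ, m < k → S.Guarded m → (S.subst R k).Guarded m := by
  induction S with
  | fail => intros; trivial
  | var n =>
      intro k m h h'
      have h' : n ≠ m := h'
      simp only [CE.subst]
      split_ifs
      · exact hR.guarded m
      · change n - 1 ≠ m
        omega
      · exact h'
  | pattern u S ih => intro k m h h'; exact ih k m h h'
  | choice S S' ih ih' => intro k m h h'; exact ⟨ih k m h h'.1, ih' k m h h'.2⟩
  | mu S ih => intro k m h h'; exact ih (k + 1) (m + 1) (by omega) h'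
  | jumps I S root ih => intros; trivial
  | most S ih => intros; trivial
  | ifThen S S' ih ih' => intro k m h h'; exact ⟨ih k m h h'.1, ih' k m h h'.2⟩

theorem IsMonotone.subst {R : CE L X} (hR : R.Closed) (hR' : R.IsMonotone) (S : CE L X) :
    ∀ k : ℕ, S.IsMonotone → (S.subst R k).IsMonotone := by
  induction S with
  | fail => intros; trivial
  | var n =>
      intro k h
      simp only [CE.subst]
      split_ifs
      · exact hR'
      · trivial
      · trivial
  | pattern u S ih => intro k h; exact ih k h
  | choice S S' ih ih' => intro k h; exact ⟨ih k h.1, ih' k h.2⟩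
  | mu S ih =>
      intro k h
      exact ⟨Guarded.subst hR S (k + 1) 0 (by omega) h.1, ih (k + 1) h.2⟩
  | jumps I S root ih => intro k h i; exact ih i k (h i)
  | most S ih => intro k h; exact ih k h
  | ifThen S S' ih ih' => intro k h; exact ⟨ih k h.1, ih' k h.2⟩

theorem closed_apply_mu {S : CE L X} (h : (mu S).Closed) : (S.apply (mu S)).Closed :=
  closedAt_subst _ h S 0 h

theorem isMonotone_apply_mu {S : CE L X} (h : (mu S).Closed) (h' : (mu S).IsMonotone) :
    (S.apply (mu S)).IsMonotone :=
  IsMonotone.subst h h' S 0 h'.2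

/-- Number of constructors that are reached without passing a jump, `Most`, or the condition
of a conditional. -/
def headSize : CE L X → ℕ
  | fail => 0
  | var _ => 0
  | pattern _ S => S.headSize + 1
  | choice S S' => S.headSize + S'.headSize + 1
  | mu S => S.headSize + 1
  | jumps _ _ _ => 0
  | most _ => 0
  | ifThen _ S' => S'.headSize + 1

/-- `headSize` stops at jumps and at `Most`, and skips conditions, so it never sees a guarded
variable or what replaces it. -/
theorem headSize_subst (R S : CE L X) :
    ∀ k : ℕ, S.Guarded k → (S.subst R k).headSize = S.headSize := by
  induction S with
  | fail => intros; rfl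
  | var n =>
      intro k h
      have h : n ≠ k := h
      simp only [subst, if_neg h]
      split_ifs <;> rfl
  | pattern u S ih => intro k h; simp [subst, headSize, ih k h]
  | choice S S' ih ih' => intro k h; simp [subst, headSize, ih k h.1, ih' k h.2]
  | mu S ih => intro k h; simp [subst, headSize, ih (k + 1) h]
  | jumps I S root ih => intros; rfl
  | most S ih => intros; rfl
  | ifThen S S' ih ih' => intro k h; simp [subst, headSize, ih' k h.2]

/-- Unfolding a monotone fixed point removes the outer `μ` and adds nothing above the jumps. This is
the source of guardedness for the variables that unification creates. -/
theorem headSize_apply_mu {S : CE L X} (h : (mu S).IsMonotone) :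
    (S.apply (mu S)).headSize < (mu S).headSize := by
  rw [apply, headSize_subst _ _ _ h.1, headSize]
  omega

/-- Nesting depth, in which `Most` counts twice. -/
def size : CE L X → ℕ
  | fail => 0
  | var _ => 0
  | pattern _ S => S.size + 1
  | choice S S' => max S.size S'.size + 1
  | mu S => S.size + 1
  | jumps _ S _ => (Finset.univ.sup fun i => (S i).size) + 1
  | most S => S.size + 2
  | ifThen _ S' => S'.size + 1

theorem size_jumps_lt {I : Finset ℕ} (S : {i : ℕ // i ∈ I} → CE L X) (r : Option (Ctx L X))
    (i : {i : ℕ // i ∈ I}) : (S i).size < (jumps I S r).size :=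
  Nat.lt_succ_of_le (Finset.le_sup (f := fun i => (S i).size) (Finset.mem_univ i))

/-- The double weight of `Most` in `size` lets its replacement by a list count as a decrease. -/
theorem size_mostList_lt (N : ℕ) (S : CE L X) : (PreCE.mostList N S).size < (most S).size := by
  have : ((Finset.univ : Finset {i : ℕ // i ∈ Finset.Icc 1 N}).sup fun _ => S.size) ≤ S.size :=
    Finset.sup_le fun _ _ => le_rfl
  simp only [PreCE.mostList, size]
  omega

/-! ### Finiteness of the set of derivatives -/

/-- The strategies that a reduction may put in place of a component of a tuple. -/
inductive Deriv (N : ℕ) : CE L X → CE L X → Prop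
  | pattern {u S} : Deriv N (pattern u S) S
  | choice_left {S S'} : Deriv N (choice S S') S
  | choice_right {S S'} : Deriv N (choice S S') S'
  | mu {S} : Deriv N (mu S) (S.apply (mu S))
  | jumps {I S r} (i : {i : ℕ // i ∈ I}) : Deriv N (jumps I S r) (S i)
  | most {S} : Deriv N (most S) S
  | most_list {S} : Deriv N (most S) (PreCE.mostList N S)
  | ifThen {S S'} : Deriv N (ifThen S S') S'

/-- Simultaneous substitution of the closed strategies `σ 0, σ 1, …` for the variables
`k, k + 1, …`. -/
def inst : CE L X → (ℕ → CE L X) → ℕ → CE L X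
  | fail, _, _ => fail
  | var n, σ, k => if n < k then var n else σ (n - k)
  | pattern u S, σ, k => pattern u (S.inst σ k)
  | choice S S', σ, k => choice (S.inst σ k) (S'.inst σ k)
  | mu S, σ, k => mu (S.inst σ (k + 1))
  | jumps I S root, σ, k => jumps I (fun i => (S i).inst σ k) root
  | most S, σ, k => most (S.inst σ k)
  | ifThen S S', σ, k => ifThen (S.inst σ k) (S'.inst σ k)

theorem inst_of_closedAt (σ : ℕ → CE L X) (S : CE L X) :
    ∀ k, S.ClosedAt k → S.inst σ k = S := by
  induction S with
  | fail => intros; rfl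
  | var n => intro k h; exact if_pos h
  | pattern u S ih => intro k h; simp [inst, ih k h]
  | choice S S' ih ih' => intro k h; simp [inst, ih k h.1, ih' k h.2]
  | mu S ih => intro k h; simp [inst, ih (k + 1) h]
  | jumps I S root ih => intro k h; simp [inst, fun i => ih i k (h i)]
  | most S ih => intro k h; simp [inst, ih k h]
  | ifThen S S' ih ih' => intro k h; simp [inst, ih k h.1, ih' k h.2]

theorem closedAt_inst {σ : ℕ → CE L X} (hσ : ∀ n, (σ n).Closed) (S : CE L X) :
    ∀ k, (S.inst σ k).ClosedAt k := by
  induction S with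
  | fail => intros; trivial
  | var n =>
      intro k
      simp only [inst]
      split_ifs with h
      · exact h
      · exact (hσ _).closedAt k
  | pattern u S ih => exact ih
  | choice S S' ih ih' => intro k; exact ⟨ih k, ih' k⟩
  | mu S ih => intro k; exact ih (k + 1)
  | jumps I S root ih => intro k i; exact ih i k
  | most S ih => exact ih
  | ifThen S S' ih ih' => intro k; exact ⟨ih k, ih' k⟩

/-- With `R` the fixed point itself, unfolding an instance gives an instance of the original body.
Repeated unfolding thus creates no new shapes. -/
theorem subst_inst {σ : ℕ → CE L X} (hσ : ∀ n, (σ n).Closed) (R S : CE L X) :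
    ∀ k, (S.inst σ (k + 1)).subst R k = S.inst (extend R σ) k := by
  induction S with
  | fail => intros; rfl
  | var n =>
      intro k
      rcases lt_trichotomy n k with h | rfl | h
      · simp [inst, subst, h, h.ne, h.not_gt, Nat.lt_succ_of_lt h]
      · simp [inst, subst, extend]
      · obtain ⟨m, rfl⟩ : ∃ m, n = k + 1 + m := ⟨n - (k + 1), by omega⟩
        have e : k + 1 + m - k = m + 1 := by omega
        have e' : k + 1 + m - (k + 1) = m := by omega
        rw [inst, inst, if_neg (by omega), if_neg (by omega), e, e', extend,
          subst_of_closedAt R _ k ((hσ m).closedAt k)]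
  | pattern u S ih => intro k; simp [inst, subst, ih k]
  | choice S S' ih ih' => intro k; simp [inst, subst, ih k, ih' k]
  | mu S ih => intro k; simp [inst, subst, ih (k + 1)]
  | jumps I S root ih => intro k; simp [inst, subst, fun i => ih i k]
  | most S ih => intro k; simp [inst, subst, ih k]
  | ifThen S S' ih ih' => intro k; simp [inst, subst, ih k, ih' k]

/-- The instances under `σ` of the subterms of a strategy, in which a variable bound by `μ` is
replaced by the instance of the fixed point that binds it. -/
def closure (N : ℕ) : CE L X → (ℕ → CE L X) → Set (CE L X)
  | fail, _ => {fail}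
  | var n, σ => {σ n}
  | pattern u S, σ => Set.insert ((pattern u S).inst σ 0) (S.closure N σ)
  | choice S S', σ => Set.insert ((choice S S').inst σ 0) (S.closure N σ ∪ S'.closure N σ)
  | mu S, σ => Set.insert ((mu S).inst σ 0) (S.closure N (extend ((mu S).inst σ 0) σ))
  | jumps I S root, σ => Set.insert ((jumps I S root).inst σ 0) (⋃ i, (S i).closure N σ)
  | most S, σ => Set.insert ((most S).inst σ 0)
      (Set.insert (PreCE.mostList N (S.inst σ 0)) (S.closure N σ))
  | ifThen S S', σ => Set.insert ((ifThen S S').inst σ 0) (S'.closure N σ)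

theorem finite_closure (N : ℕ) (S : CE L X) : ∀ σ, (S.closure N σ).Finite := by
  induction S with
  | fail => intro σ; exact Set.finite_singleton _
  | var n => intro σ; exact Set.finite_singleton _
  | pattern u S ih => intro σ; exact (ih σ).insert _
  | choice S S' ih ih' => intro σ; exact ((ih σ).union (ih' σ)).insert _
  | mu S ih => intro σ; exact (ih _).insert _
  | jumps I S root ih => intro σ; exact (Set.finite_iUnion fun i => ih i σ).insert _
  | most S ih => intro σ; exact ((ih σ).insert _).insert _
  | ifThen S S' ih ih' => intro σ; exact (ih' σ).insert _

theorem inst_mem_closure (N : ℕ) (S : CE L X) (σ : ℕ → CE L X) :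
    S.inst σ 0 ∈ S.closure N σ := by
  cases S <;> first | exact Set.mem_insert _ _ | exact Set.mem_singleton _

/-- A variable contributes `σ n`, whose derivatives may lie outside the closure; this forces the
first alternative. Under `μ`, index `0` stands for the fixed point itself, whose unfolding is again
in the closure, and the other indices are passed outwards. -/
theorem closure_deriv (N : ℕ) (S : CE L X) : ∀ σ : ℕ → CE L X, (∀ n, (σ n).Closed) →
    ∀ T ∈ S.closure N σ, (∃ n, T = σ n) ∨ ∀ T', Deriv N T T' → T' ∈ S.closure N σ := by
  induction S with
  | fail =>
      rintro σ - T rfl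
      exact .inr fun T' h => by cases h
  | var n => exact fun σ _ T hT => .inl ⟨n, hT⟩
  | pattern u S ih =>
      rintro σ hσ T (rfl | hT)
      · refine .inr fun T' h => ?_
        cases h
        exact .inr (inst_mem_closure N S σ)
      · exact (ih σ hσ T hT).imp_right fun h T' hT' => .inr (h T' hT')
  | choice S S' ih ih' =>
      rintro σ hσ T (rfl | hT | hT)
      · refine .inr fun T' h => ?_
        cases h
        · exact .inr (.inl (inst_mem_closure N S σ))
        · exact .inr (.inr (inst_mem_closure N S' σ))
      · exact (ih σ hσ T hT).imp_right fun h T' hT' => .inr (.inl (h T' hT'))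
      · exact (ih' σ hσ T hT).imp_right fun h T' hT' => .inr (.inr (h T' hT'))
  | mu S ih =>
      intro σ hσ T hT
      have unfold_mem : ∀ T', Deriv N ((mu S).inst σ 0) T' → T' ∈ (mu S).closure N σ := by
        intro T' h
        cases h
        refine .inr ?_
        have e : (S.inst σ 1).apply (mu (S.inst σ 1)) =
          S.inst (extend ((mu S).inst σ 0) σ) 0 := subst_inst hσ _ S 0
        rw [e]
        exact inst_mem_closure N S _
      rcases hT with rfl | hT
      · exact .inr unfold_mem
      · have hσ' : ∀ n, (extend ((mu S).inst σ 0) σ n).Closed := by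
          rintro (_ | n)
          · exact closedAt_inst hσ (mu S) 0
          · exact hσ n
        rcases ih _ hσ' T hT with ⟨_ | n, rfl⟩ | h
        · exact .inr unfold_mem
        · exact .inl ⟨n, rfl⟩
        · exact .inr fun T' hT' => .inr (h T' hT')
  | jumps I S root ih =>
      rintro σ hσ T (rfl | hT)
      · refine .inr fun T' h => ?_
        cases h with
        | jumps i => exact .inr (Set.mem_iUnion.2 ⟨i, inst_mem_closure N (S i) σ⟩)
      · obtain ⟨i, hT⟩ := Set.mem_iUnion.1 hT
        exact (ih i σ hσ T hT).imp_right fun h T' hT' => .inr (Set.mem_iUnion.2 ⟨i, h T' hT'⟩)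
  | most S ih =>
      rintro σ hσ T (rfl | rfl | hT)
      · refine .inr fun T' h => ?_
        cases h
        · exact .inr (.inr (inst_mem_closure N S σ))
        · exact .inr (.inl rfl)
      · refine .inr fun T' h => ?_
        cases h
        exact .inr (.inr (inst_mem_closure N S σ))
      · exact (ih σ hσ T hT).imp_right fun h T' hT' => .inr (.inr (h T' hT'))
  | ifThen S S' ih ih' =>
      rintro σ hσ T (rfl | hT)
      · refine .inr fun T' h => ?_
        cases h
        exact .inr (inst_mem_closure N S' σ)
      · exact (ih' σ hσ T hT).imp_right fun h T' hT' => .inr (h T' hT')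

theorem exists_finset_deriv_closed (N : ℕ) {S : CE L X} (hS : S.Closed) :
    ∃ A : Finset (CE L X), S ∈ A ∧ ∀ T ∈ A, ∀ T', Deriv N T T' → T' ∈ A := by
  refine ⟨(finite_closure N S fun _ => fail).toFinset, ?_, fun T hT T' hT' => ?_⟩
  · rw [Set.Finite.mem_toFinset]
    have := inst_mem_closure N S fun _ => fail
    rwa [inst_of_closedAt _ S 0 hS] at this
  · rw [Set.Finite.mem_toFinset] at hT ⊢
    rcases closure_deriv N S (fun _ => fail) (fun _ => trivial) T hT with ⟨n, rfl⟩ | h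
    -- The default `fail` in the environment has no derivatives, so the exceptional alternative is
    -- harmless for closed strategies.
    · cases hT'
    · exact h T' hT'

/-! ### Dependence of the translation on the environment -/

theorem psi_congr_on {D : Set (L.Term X)} (hD : ∀ t ∈ D, ∀ i c, child t i = some c → c ∈ D)
    (S : CE L X) : ∀ ρ ρ' : ℕ → L.Term X → PosCE L X, (∀ n, ∀ t ∈ D, ρ n t = ρ' n t) →
    ∀ t ∈ D, S.psi ρ t = S.psi ρ' t := by
  have hmap : ∀ {f g : L.Term X → PosCE L X}, (∀ t ∈ D, f t = g t) → ∀ t ∈ D, ∀ i,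
      ((child t i).map f).getD PosCE.fail = ((child t i).map g).getD PosCE.fail := by
    intro f g h t ht i
    cases hc : child t i with
    | none => rfl
    | some c => exact h c (hD t ht i c hc)
  induction S with
  | fail => intros; simp [psi]
  | var n => intro ρ ρ' e t ht; simpa [psi] using e n t ht
  | pattern u S ih => intro ρ ρ' e t ht; simp [psi, ih ρ ρ' e t ht]
  | choice S S' ih ih' => intro ρ ρ' e t ht; simp only [psi]; rw [ih ρ ρ' e t ht, ih' ρ ρ' e t ht]
  | mu S ih =>
      intro ρ ρ' e t ht
      have : ∀ m, ∀ s ∈ D, (fun F => S.psi (extend F ρ))^[m] (fun _ => PosCE.fail) s =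
          (fun F => S.psi (extend F ρ'))^[m] (fun _ => PosCE.fail) s := by
        intro m
        induction m with
        | zero => intros; rfl
        | succ m ihm =>
            intro s hs
            rw [Function.iterate_succ_apply', Function.iterate_succ_apply']
            refine ih _ _ ?_ s hs
            rintro (_ | n)
            · exact ihm
            · exact e n
      simpa [psi] using this _ t ht
  | jumps I S root ih =>
      intro ρ ρ' e t ht
      simp only [psi]
      congr 1
      funext i
      split_ifs with h
      · exact hmap (ih ⟨i, h⟩ ρ ρ' e) t ht i
      · rfl
  | most S ih =>
      intro ρ ρ' e t ht
      simp only [psi]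
      congr 1
      funext i
      exact hmap (ih ρ ρ' e) t ht i
  | ifThen S S' ih ih' => intro ρ ρ' e t ht; simp only [psi]; rw [ih ρ ρ' e t ht, ih' ρ ρ' e t ht]

/-- A guarded variable is evaluated only at proper subterms, so agreement on `D'`, which contains
the children of `D`, suffices for it. Below a jump everything happens inside `D'`, where
`psi_congr_on` applies. -/
theorem psi_congr_of_guarded {D D' : Set (L.Term X)}
    (hDD' : ∀ t ∈ D, ∀ i c, child t i = some c → c ∈ D') (hD' : D' ⊆ D) (S : CE L X) :
    ∀ (k : ℕ) (ρ ρ' : ℕ → L.Term X → PosCE L X), S.Guarded k →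
    (∀ n, n ≠ k → ∀ t ∈ D, ρ n t = ρ' n t) → (∀ t ∈ D', ρ k t = ρ' k t) →
    ∀ t ∈ D, S.psi ρ t = S.psi ρ' t := by
  have hmap : ∀ {k : ℕ} {ρ ρ' : ℕ → L.Term X → PosCE L X},
      (∀ n, n ≠ k → ∀ t ∈ D, ρ n t = ρ' n t) → (∀ t ∈ D', ρ k t = ρ' k t) →
      ∀ T : CE L X, ∀ t ∈ D, ∀ i, ((child t i).map (T.psi ρ)).getD PosCE.fail =
        ((child t i).map (T.psi ρ')).getD PosCE.fail := by
    intro k ρ ρ' e e' T t ht i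
    cases hc : child t i with
    | none => rfl
    | some c =>
        refine psi_congr_on (fun t ht => hDD' t (hD' ht)) T ρ ρ' (fun n s hs => ?_) c
          (hDD' t ht i c hc)
        by_cases hn : n = k
        · exact hn ▸ e' s hs
        · exact e n hn s (hD' hs)
  induction S with
  | fail => intros; simp [psi]
  | var n => intro k ρ ρ' h e e' t ht; simpa [psi] using e n h t ht
  | pattern u S ih => intro k ρ ρ' h e e' t ht; simp [psi, ih k ρ ρ' h e e' t ht]
  | choice S S' ih ih' =>
      intro k ρ ρ' h e e' t ht
      simp only [psi]; rw [ih k ρ ρ' h.1 e e' t ht, ih' k ρ ρ' h.2 e e' t ht]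
  | mu S ih =>
      intro k ρ ρ' h e e' t ht
      have : ∀ m, ∀ s ∈ D, (fun F => S.psi (extend F ρ))^[m] (fun _ => PosCE.fail) s =
          (fun F => S.psi (extend F ρ'))^[m] (fun _ => PosCE.fail) s := by
        intro m
        induction m with
        | zero => intros; rfl
        | succ m ihm =>
            intro s hs
            rw [Function.iterate_succ_apply', Function.iterate_succ_apply']
            refine ih (k + 1) _ _ h ?_ e' s hs
            rintro (_ | n) hn
            · exact ihm
            · exact e n (by omega)
      simpa [psi] using this _ t ht
  | jumps I S root ih =>
      intro k ρ ρ' h e e' t ht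
      simp only [psi]
      congr 1
      funext i
      split_ifs with hi
      · exact hmap e e' _ t ht i
      · rfl
  | most S ih =>
      intro k ρ ρ' h e e' t ht
      simp only [psi]
      congr 1
      funext i
      exact hmap e e' _ t ht i
  | ifThen S S' ih ih' =>
      intro k ρ ρ' h e e' t ht
      simp only [psi]; rw [ih k ρ ρ' h.1 e e' t ht, ih' k ρ ρ' h.2 e e' t ht]

theorem psi_extend_congr {N : ℕ} {S : CE L X} (hS : S.Guarded 0)
    (ρ : ℕ → L.Term X → PosCE L X) {d : ℕ} {F F' : L.Term X → PosCE L X}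
    (h : ∀ t, depth t ≤ d → ArityLE N t → F t = F' t) (t : L.Term X) (ht : depth t ≤ d + 1)
    (ht' : ArityLE N t) : S.psi (extend F ρ) t = S.psi (extend F' ρ) t := by
  refine psi_congr_of_guarded (D := {t | depth t ≤ d + 1 ∧ ArityLE N t})
    (D' := {t | depth t ≤ d ∧ ArityLE N t}) ?_ ?_ S 0 _ _ hS ?_ ?_ t ⟨ht, ht'⟩
  · rintro t ⟨h1, h2⟩ i c hc
    exact ⟨by have := depth_child_lt hc; omega, h2.child hc⟩
  · rintro t ⟨h1, h2⟩
    exact ⟨by omega, h2⟩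
  · rintro (_ | n) hn s -
    · exact absurd rfl hn
    · rfl
  · rintro s ⟨h1, h2⟩
    exact h s h1 h2

/-- Each iteration extends the agreement with `G` by one level of depth. The equation for `G` is
asked only under the arity bound, which subterms inherit, since the correctness of unifiers is known
only there. -/
theorem psi_mu_eq_of_fixed {N : ℕ} {S : CE L X} (hS : S.Guarded 0)
    (ρ : ℕ → L.Term X → PosCE L X) {G : L.Term X → PosCE L X}
    (hG : ∀ t, ArityLE N t → S.psi (extend G ρ) t = G t) (t : L.Term X) (ht : ArityLE N t) :
    (mu S).psi ρ t = G t := by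
  have : ∀ m t, depth t ≤ m → ArityLE N t →
      (fun F => S.psi (extend F ρ))^[m] (fun _ => PosCE.fail) t = G t := by
    intro m
    induction m with
    | zero => intro t h _; exact absurd (depth_pos t) (by omega)
    | succ m ih =>
        intro t h h'
        rw [Function.iterate_succ_apply', ← hG t h']
        exact psi_extend_congr hS ρ ih t h h'
  simpa [psi] using this _ t le_rfl ht

theorem psi_mu_unfold {N : ℕ} {S : CE L X} (hS : S.Guarded 0) (ρ : ℕ → L.Term X → PosCE L X)
    (t : L.Term X) (ht : ArityLE N t) :
    S.psi (extend ((mu S).psi ρ) ρ) t = (mu S).psi ρ t := by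
  set Φ : (L.Term X → PosCE L X) → L.Term X → PosCE L X := fun F => S.psi (extend F ρ) with hΦ
  have stable : ∀ m t, depth t ≤ m → ArityLE N t → ∀ n, m ≤ n →
      Φ^[n] (fun _ => PosCE.fail) t = Φ^[m] (fun _ => PosCE.fail) t := by
    intro m
    induction m with
    | zero => intro t h _; exact absurd (depth_pos t) (by omega)
    | succ m ih =>
        intro t h h' n hn
        obtain ⟨n, rfl⟩ : ∃ k, n = k + 1 := ⟨n - 1, by omega⟩
        rw [Function.iterate_succ_apply', Function.iterate_succ_apply']
        exact psi_extend_congr hS ρ (fun s hs hs' => ih s hs hs' n (by omega)) t h h'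
  have hmu : ∀ t, (mu S).psi ρ t = Φ^[depth t] (fun _ => PosCE.fail) t := fun t => by simp [psi, hΦ]
  obtain ⟨d, hd⟩ : ∃ d, depth t = d + 1 := ⟨depth t - 1, by have := depth_pos t; omega⟩
  rw [hmu, hd, Function.iterate_succ_apply']
  -- One iterate has been peeled off. The remaining `d` iterates have already stabilised on terms of
  -- depth at most `d`, which are all that the guarded body consults.
  refine psi_extend_congr hS ρ (fun s hs hs' => ?_) t hd.le ht
  rw [hmu]
  exact (stable _ s le_rfl hs' d hs).symm

theorem Closed.psi_eq {S : CE L X} (hS : S.Closed) (ρ : ℕ → L.Term X → PosCE L X)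
    (t : L.Term X) : S.psi ρ t = Psi t S :=
  congrFun (psi_congr S 0 _ _ hS fun _ h => absurd h (Nat.not_lt_zero _)) t

theorem Psi_apply_mu {N : ℕ} {S : CE L X} (hS : (mu S).Closed) (hS' : (mu S).IsMonotone)
    (t : L.Term X) (ht : ArityLE N t) : Psi t (S.apply (mu S)) = Psi t (mu S) := by
  rw [Psi, apply, psi_subst _ hS S 0 (fun _ _ => PosCE.fail)
    (extend ((mu S).psi fun _ _ => PosCE.fail) fun _ _ => PosCE.fail)
    (fun _ h => absurd h (Nat.not_lt_zero _)) rfl (fun _ _ => rfl)]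
  exact psi_mu_unfold hS'.1 _ t ht

/-- Jumps beyond the arity of `t` find no child and contribute nothing; the bound `N` ensures that
no child is missed. -/
theorem Psi_mostList {N : ℕ} (S : CE L X) (t : L.Term X) (ht : ArityLE N t) :
    Psi t (PreCE.mostList N S) = Psi t (most S) := by
  simp only [Psi, PreCE.mostList, psi]
  ext1
  funext p
  rcases p with _ | ⟨i, q⟩
  · rfl
  · have := ht.arity_le
    by_cases hi : i ∈ Finset.Icc 1 (arity t)
    · have hi' : i ∈ Finset.Icc 1 N := by
        simp only [Finset.mem_Icc] at hi ⊢
        omega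
      simp only [PosCE.jumps, if_pos hi, if_pos hi', dif_pos hi']
    · simp [PosCE.jumps, child_eq_none hi]

end CE

namespace PreCE

/-! ### Normal forms -/

/-- Big-step evaluation of pre-strategies. -/
inductive Eval (N : ℕ) : PreCE L X → CE L X → Prop
  | tuple {S R M P U} : rule N S R M = some P → Eval N P U → Eval N (tuple S R M) U
  | fail : Eval N fail .fail
  | var (k) : Eval N (var k) (.var k)
  | pattern {u P U} : Eval N P U → Eval N (pattern u P) (.pattern u U)
  | choice {P P' U U'} : Eval N P U → Eval N P' U' → Eval N (choice P P') (.choice U U')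
  | mu {P U} : Eval N P U → Eval N (mu P) (.mu U)
  | jumps {I P root U} : (∀ i, Eval N (P i) (U i)) → Eval N (jumps I P root) (.jumps I U root)
  | most {P U} : Eval N P U → Eval N (most P) (.most U)
  | ifThen {S P U} : Eval N P U → Eval N (ifThen S P) (.ifThen S U)

theorem eval_toPre (N : ℕ) (S : CE L X) : Eval N S.toPre S := by
  induction S with
  | fail => exact .fail
  | var n => exact .var n
  | pattern u S ih => exact .pattern ih
  | choice S S' ih ih' => exact .choice ih ih'
  | mu S ih => exact .mu ih
  | jumps I S root ih => exact .jumps ih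
  | most S ih => exact .most ih
  | ifThen S S' ih ih' => exact .ifThen ih'

/-- Since `rule` is a function, a step can only carry out part of the evaluation. This takes the
place of a confluence argument. -/
theorem Eval.step {N : ℕ} {P Q : PreCE L X} (h : Step N P Q) :
    ∀ {U : CE L X}, Eval N P U → Eval N Q U := by
  induction h with
  | tuple hr =>
      intro U hU
      cases hU with
      | tuple hr' hU =>
          rw [hr] at hr'
          cases hr'
          exact hU
  | pattern _ ih => rintro _ (_ | _); exact .pattern (ih ‹_›)
  | choice_left _ ih => rintro _ (_ | _); exact .choice (ih ‹_›) ‹_›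
  | choice_right _ ih => rintro _ (_ | _); exact .choice ‹_› (ih ‹_›)
  | mu _ ih => rintro _ (_ | _); exact .mu (ih ‹_›)
  | jumps i _ ih =>
      intro U hU
      cases hU with
      | jumps hU =>
          refine .jumps fun j => ?_
          by_cases hj : j = i
          · subst hj
            rw [Function.update_self]
            exact ih (hU j)
          · rw [Function.update_of_ne hj]
            exact hU j
  | most _ ih => rintro _ (_ | _); exact .most (ih ‹_›)
  | ifThen _ ih => rintro _ (_ | _); exact .ifThen (ih ‹_›)

open Relation in
-- A step changes one component of a list, so the components are reduced one at a time, by induction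
-- on the set of those already treated.
theorem steps_jumps {N : ℕ} {I : Finset ℕ} {P P' : {i : ℕ // i ∈ I} → PreCE L X}
    {root : Option (Ctx L X)} (h : ∀ i, ReflTransGen (Step N) (P i) (P' i)) :
    ReflTransGen (Step N) (jumps I P root) (jumps I P' root) := by
  have single : ∀ (Q : {i : ℕ // i ∈ I} → PreCE L X) i T, ReflTransGen (Step N) (Q i) T →
      ReflTransGen (Step N) (jumps I Q root) (jumps I (Function.update Q i T) root) := by
    intro Q i T hT
    induction hT with
    | refl => rw [Function.update_eq_self]
    | tail _ hs ih =>
        refine ih.tail ?_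
        have := Step.jumps (root := root) (P := Function.update Q i _) i
          (by rw [Function.update_self]; exact hs)
        rwa [Function.update_idem] at this
  have key : ∀ s : Finset {i : ℕ // i ∈ I}, ReflTransGen (Step N) (jumps I P root)
      (jumps I (fun i => if i ∈ s then P' i else P i) root) := by
    intro s
    induction s using Finset.induction_on with
    | empty => simpa using ReflTransGen.refl
    | insert a s ha ih =>
        refine ih.trans ?_
        have := single (fun i => if i ∈ s then P' i else P i) a (P' a) (by simpa [ha] using h a)
        convert this using 2
        funext i
        by_cases hi : i = a
        · subst hi; simp
        · simp [hi]
  simpa using key Finset.univ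

open Relation in
theorem Eval.steps {N : ℕ} {P : PreCE L X} {U : CE L X} (h : Eval N P U) :
    ReflTransGen (Step N) P U.toPre := by
  induction h with
  | tuple hr _ ih => exact .head (.tuple hr) ih
  | fail => exact .refl
  | var k => exact .refl
  | pattern _ ih => exact ih.lift _ fun _ _ => .pattern
  | choice _ _ ih ih' =>
      exact (ih.lift (PreCE.choice · _) fun _ _ => .choice_left).trans
        (ih'.lift (PreCE.choice _ ·) fun _ _ => .choice_right)
  | mu _ ih => exact ih.lift _ fun _ _ => .mu
  | jumps _ ih => exact steps_jumps ih
  | most _ ih => exact ih.lift _ fun _ _ => .most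
  | ifThen _ ih => exact ih.lift _ fun _ _ => .ifThen

theorem not_step_toPre (N : ℕ) (S : CE L X) : ∀ Q, ¬ Step N S.toPre Q := by
  induction S with
  | fail => rintro Q (_ | _)
  | var n => rintro Q (_ | _)
  | pattern u S ih => rintro Q (_ | h); exact ih _ h
  | choice S S' ih ih' =>
      intro Q h
      cases h with
      | choice_left h => exact ih _ h
      | choice_right h => exact ih' _ h
  | mu S ih =>
      intro Q h
      cases h with
      | mu h => exact ih _ h
  | jumps I S root ih =>
      intro Q h
      cases h with
      | jumps i h => exact ih i _ h
  | most S ih =>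
      intro Q h
      cases h with
      | most h => exact ih _ h
  | ifThen S S' ih ih' =>
      intro Q h
      cases h with
      | ifThen h => exact ih' _ h

theorem Eval.eq_toPre {N : ℕ} {P : PreCE L X} {U : CE L X} (h : Eval N P U)
    (hP : ∀ Q, ¬ Step N P Q) : P = U.toPre := by
  induction h with
  | tuple hr _ _ => exact absurd (.tuple hr) (hP _)
  | fail => rfl
  | var k => rfl
  | pattern _ ih => simp only [CE.toPre]; rw [← ih fun Q hs => hP _ (.pattern hs)]
  | choice _ _ ih ih' =>
      simp only [CE.toPre]
      rw [← ih fun Q hs => hP _ (.choice_left hs), ← ih' fun Q hs => hP _ (.choice_right hs)]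
  | mu _ ih => simp only [CE.toPre]; rw [← ih fun Q hs => hP _ (.mu hs)]
  | jumps _ ih =>
      simp only [CE.toPre]
      congr 1
      funext i
      exact ih i fun Q hs => hP _ (.jumps i hs)
  | most _ ih => simp only [CE.toPre]; rw [← ih fun Q hs => hP _ (.most hs)]
  | ifThen _ ih => simp only [CE.toPre]; rw [← ih fun Q hs => hP _ (.ifThen hs)]

theorem Eval.isNormalForm_iff {N : ℕ} {P : PreCE L X} {U : CE L X} (h : Eval N P U)
    (Q : PreCE L X) : IsNormalForm N P Q ↔ Q = U.toPre := by
  refine ⟨fun h' => ?_, fun e => e ▸ ⟨h.steps, not_step_toPre N U⟩⟩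
  obtain ⟨hPQ, hQ⟩ := h'
  have hU : Eval N Q U := by
    clear hQ
    induction hPQ with
    | refl => exact h
    | tail _ hs ih => exact Eval.step hs ih
  exact hU.eq_toPre hQ

end PreCE

theorem CE.toPre_injective : Function.Injective (CE.toPre : CE L X → PreCE L X) := by
  intro S
  induction S with
  | fail => rintro (_ | _) h <;> first | rfl | cases h
  | var n => rintro (_ | _) h <;> first | rfl | cases h <;> rfl
  | pattern u S ih =>
      intro T h; cases T <;> simp only [toPre, reduceCtorEq, PreCE.pattern.injEq] at h
      rw [h.1, ih h.2]
  | choice S S' ih ih' =>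
      intro T h; cases T <;> simp only [toPre, reduceCtorEq, PreCE.choice.injEq] at h
      rw [ih h.1, ih' h.2]
  | mu S ih =>
      intro T h; cases T <;> simp only [toPre, reduceCtorEq, PreCE.mu.injEq] at h
      rw [ih h]
  | jumps I S root ih =>
      intro T h; cases T <;> simp only [toPre, reduceCtorEq, PreCE.jumps.injEq] at h
      obtain ⟨rfl, h, rfl⟩ := h
      congr 1
      funext i
      exact ih i (congrFun (eq_of_heq h) i)
  | most S ih =>
      intro T h; cases T <;> simp only [toPre, reduceCtorEq, PreCE.most.injEq] at h
      rw [ih h]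
  | ifThen S S' ih ih' =>
      intro T h; cases T <;> simp only [toPre, reduceCtorEq, PreCE.ifThen.injEq] at h
      rw [h.1, ih' h.2]

/-! ### Invariants of derivatives and translation of choices and conditionals. -/

namespace CE

theorem Deriv.closed {N : ℕ} {S T : CE L X} (h : Deriv N S T) (hS : S.Closed) : T.Closed := by
  cases h with
  | pattern => exact hS
  | choice_left => exact hS.1
  | choice_right => exact hS.2
  | mu => exact closed_apply_mu hS
  | jumps i => exact hS i
  | most => exact hS
  | most_list => exact fun _ => hS
  | ifThen => exact hS.2

theorem Deriv.isMonotone {N : ℕ} {S T : CE L X} (h : Deriv N S T) (hS : S.Closed)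
    (hS' : S.IsMonotone) : T.IsMonotone := by
  cases h with
  | pattern => exact hS'
  | choice_left => exact hS'.1
  | choice_right => exact hS'.2
  | mu => exact isMonotone_apply_mu hS hS'
  | jumps i => exact hS' i
  | most => exact hS'
  | most_list => exact fun _ => hS'
  | ifThen => exact hS'.2

open Classical in
theorem Psi_choice (t : L.Term X) (S S' : CE L X) : Psi t (choice S S') =
    if Psi t S ≠ PosCE.fail then Psi t S else Psi t S' := by
  simp only [Psi, psi]
  congr

open Classical in
theorem Psi_ifThen (t : L.Term X) (S S' : CE L X) : Psi t (ifThen S S') =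
    if Psi t S ≠ PosCE.fail then Psi t S' else PosCE.fail := by
  simp only [Psi, psi]
  congr

end CE

/-! ### Correctness of each reduction rule. -/

open PosCE
open CE hiding fail

/-- The environment in which the variable of each entry of a memory is interpreted as the
unification of the translations of the two recorded strategies. -/
noncomputable def memEnv (M : List (CE L X × CE L X)) (n : ℕ) (t : L.Term X) : PosCE L X :=
  match M[n]? with
  | some p => (Psi t p.1).unify (Psi t p.2)
  | none => PosCE.fail

theorem memEnv_cons (p : CE L X × CE L X) (M : List (CE L X × CE L X)) :
    memEnv (p :: M) = extend (fun t => (Psi t p.1).unify (Psi t p.2)) (memEnv M) := by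
  funext n t
  cases n <;> simp [memEnv, extend]

/-- `U` is the unification of `S` and `R` under the memory `M`. -/
structure IsUnifier (N : ℕ) (S R : CE L X) (M : List (CE L X × CE L X)) (U : CE L X) : Prop where
  eval : PreCE.Eval N (.tuple S R M) U
  closedAt : U.ClosedAt M.length
  -- The variable of a recorded pair can appear unguarded only if that pair recurs before a jump or
  -- `Most`; a strictly smaller total head size excludes this.
  guarded : ∀ k p, M[k]? = some p →
    S.headSize + R.headSize < p.1.headSize + p.2.headSize → U.Guarded k
  psi_eq : ∀ t, ArityLE N t → U.psi (memEnv M) t = (Psi t S).unify (Psi t R)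

namespace IsUnifier

variable {N : ℕ} {S S' R R' U U' : CE L X} {M : List (CE L X × CE L X)}

theorem fail_left (h : PreCE.rule N S R M = some .fail) (hS : ∀ t, (Psi t S).unify (Psi t R) = fail) :
    IsUnifier N S R M .fail where
  eval := .tuple h .fail
  closedAt := trivial
  guarded := fun _ _ _ _ => trivial
  psi_eq t _ := by rw [hS]; simp [psi]

theorem pattern_left {u : L.Term X} (hU : IsUnifier N S R M U)
    (h : PreCE.rule N (.pattern u S) R M = some (.pattern u (.tuple S R M))) :
    IsUnifier N (.pattern u S) R M (.pattern u U) where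
  eval := .tuple h (.pattern hU.eval)
  closedAt := hU.closedAt
  guarded k p hp hlt := hU.guarded k p hp (by simp only [headSize] at hlt; omega)
  psi_eq t ht := by
    simp only [psi, hU.psi_eq t ht]
    by_cases hm : Matches u t <;> simp [Psi, psi, hm]

theorem pattern_right {u : L.Term X} (hU : IsUnifier N S R M U)
    (h : PreCE.rule N S (.pattern u R) M = some (.pattern u (.tuple S R M))) :
    IsUnifier N S (.pattern u R) M (.pattern u U) where
  eval := .tuple h (.pattern hU.eval)
  closedAt := hU.closedAt
  guarded k p hp hlt := hU.guarded k p hp (by simp only [headSize] at hlt; omega)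
  psi_eq t ht := by
    simp only [psi, hU.psi_eq t ht]
    by_cases hm : Matches u t <;> simp [Psi, psi, hm]

theorem choice_left (hU : IsUnifier N S R M U) (hU' : IsUnifier N S' R M U')
    (h : PreCE.rule N (.choice S S') R M = some (.choice (.tuple S R M) (.tuple S' R M))) :
    IsUnifier N (.choice S S') R M (.choice U U') where
  eval := .tuple h (.choice hU.eval hU'.eval)
  closedAt := ⟨hU.closedAt, hU'.closedAt⟩
  guarded k p hp hlt := by
    simp only [headSize] at hlt
    exact ⟨hU.guarded k p hp (by omega), hU'.guarded k p hp (by omega)⟩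
  psi_eq t ht := by
    rw [psi, hU.psi_eq t ht, hU'.psi_eq t ht, Psi_choice]
    by_cases hS : Psi t S = fail <;> by_cases hR : Psi t R = fail <;>
      simp [hS, hR, unify_eq_fail]

theorem choice_right (hU : IsUnifier N S R M U) (hU' : IsUnifier N S R' M U')
    (h : PreCE.rule N S (.choice R R') M = some (.choice (.tuple S R M) (.tuple S R' M))) :
    IsUnifier N S (.choice R R') M (.choice U U') where
  eval := .tuple h (.choice hU.eval hU'.eval)
  closedAt := ⟨hU.closedAt, hU'.closedAt⟩
  guarded k p hp hlt := by
    simp only [headSize] at hlt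
    exact ⟨hU.guarded k p hp (by omega), hU'.guarded k p hp (by omega)⟩
  psi_eq t ht := by
    rw [psi, hU.psi_eq t ht, hU'.psi_eq t ht, Psi_choice]
    by_cases hS : Psi t S = fail <;> by_cases hR : Psi t R = fail <;>
      simp [hS, hR, unify_eq_fail]

theorem ifThen_left (hS : S.Closed) (hU : IsUnifier N S' R M U)
    (h : PreCE.rule N (.ifThen S S') R M = some (.ifThen S (.tuple S' R M))) :
    IsUnifier N (.ifThen S S') R M (.ifThen S U) where
  eval := .tuple h (.ifThen hU.eval)
  closedAt := ⟨hS.closedAt _, hU.closedAt⟩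
  guarded k p hp hlt := by
    simp only [headSize] at hlt
    exact ⟨hS.guarded k, hU.guarded k p hp (by omega)⟩
  psi_eq t ht := by
    rw [psi, hU.psi_eq t ht, hS.psi_eq, Psi_ifThen]
    by_cases hS : Psi t S = fail <;> simp [hS]

theorem ifThen_right (hR : R.Closed) (hU : IsUnifier N S R' M U)
    (h : PreCE.rule N S (.ifThen R R') M = some (.ifThen R (.tuple S R' M))) :
    IsUnifier N S (.ifThen R R') M (.ifThen R U) where
  eval := .tuple h (.ifThen hU.eval)
  closedAt := ⟨hR.closedAt _, hU.closedAt⟩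
  guarded k p hp hlt := by
    simp only [headSize] at hlt
    exact ⟨hR.guarded k, hU.guarded k p hp (by omega)⟩
  psi_eq t ht := by
    rw [psi, hU.psi_eq t ht, hR.psi_eq, Psi_ifThen]
    by_cases hS : Psi t R = fail <;> simp [hS]

theorem mostList_left (hU : IsUnifier N (PreCE.mostList N S) R M U)
    (h : PreCE.rule N (.most S) R M = some (.tuple (PreCE.mostList N S) R M)) :
    IsUnifier N (.most S) R M U where
  eval := .tuple h hU.eval
  closedAt := hU.closedAt
  guarded := hU.guarded
  psi_eq t ht := by rw [hU.psi_eq t ht, Psi_mostList S t ht]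

theorem mostList_right (hU : IsUnifier N S (PreCE.mostList N R) M U)
    (h : PreCE.rule N S (.most R) M = some (.tuple S (PreCE.mostList N R) M)) :
    IsUnifier N S (.most R) M U where
  eval := .tuple h hU.eval
  closedAt := hU.closedAt
  guarded := hU.guarded
  psi_eq t ht := by rw [hU.psi_eq t ht, Psi_mostList R t ht]

theorem mu_left (hS : (mu S).Closed) (hS' : (mu S).IsMonotone)
    (hU : IsUnifier N (S.apply (.mu S)) R ((.mu S, R) :: M) U)
    (h : PreCE.rule N (.mu S) R M =
      some (.mu (.tuple (S.apply (.mu S)) R ((.mu S, R) :: M)))) :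
    IsUnifier N (.mu S) R M (.mu U) where
  eval := .tuple h (.mu hU.eval)
  closedAt := hU.closedAt
  guarded k p hp hlt := by
    have := headSize_apply_mu hS'
    exact hU.guarded (k + 1) p hp (by omega)
  psi_eq t ht := by
    have hg : U.Guarded 0 := by
      have := headSize_apply_mu hS'
      exact hU.guarded 0 _ rfl (by simpa using this)
    -- This `G` is also what `memEnv` assigns to the new variable, so correctness of the body
    -- together with one unfolding says that `G` is a fixed point.
    refine psi_mu_eq_of_fixed hg (memEnv M) (G := fun t => (Psi t (.mu S)).unify (Psi t R))
      (fun t ht => ?_) t ht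
    rw [← memEnv_cons (mu S, R), hU.psi_eq t ht, Psi_apply_mu hS hS' t ht]

theorem mu_right (hR : (mu R).Closed) (hR' : (mu R).IsMonotone)
    (hU : IsUnifier N S (R.apply (.mu R)) ((S, .mu R) :: M) U)
    (h : PreCE.rule N S (.mu R) M =
      some (.mu (.tuple S (R.apply (.mu R)) ((S, .mu R) :: M)))) :
    IsUnifier N S (.mu R) M (.mu U) where
  eval := .tuple h (.mu hU.eval)
  closedAt := hU.closedAt
  guarded k p hp hlt := by
    have := headSize_apply_mu hR'
    exact hU.guarded (k + 1) p hp (by omega)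
  psi_eq t ht := by
    have hg : U.Guarded 0 := by
      have := headSize_apply_mu hR'
      exact hU.guarded 0 _ rfl (by simpa using this)
    refine psi_mu_eq_of_fixed hg (memEnv M) (G := fun t => (Psi t S).unify (Psi t (.mu R)))
      (fun t ht => ?_) t ht
    rw [← memEnv_cons (S, mu R), hU.psi_eq t ht, Psi_apply_mu hR hR' t ht]

theorem var_of_getElem? {k : ℕ} (hk : M[k]? = some (S, R))
    (h : PreCE.rule N S R M = some (.var k)) : IsUnifier N S R M (.var k) where
  eval := .tuple h (.var k)
  closedAt := (List.getElem?_eq_some_iff.1 hk).1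
  guarded j p hp hlt := by
    rintro rfl
    rw [hk] at hp
    cases hp
    -- The entry at index `k` is the current pair, so the two head sizes coincide.
    exact lt_irrefl _ hlt
  psi_eq t _ := by simp [psi, memEnv, hk]

/-- Explains the shape `⟨S, R, M⟩ ⊕ S ⊕ R` that the rules place below a common jump. -/
theorem psi_combine (hS : S.Closed) (hR : R.Closed) (hU : IsUnifier N S R M U) (t : L.Term X)
    (ht : ArityLE N t) :
    (choice U (choice S R)).psi (memEnv M) t = (Psi t S).mergeAll (Psi t R) := by
  rw [← choice_unify_eq_mergeAll]
  simp only [psi]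
  rw [hU.psi_eq t ht, hS.psi_eq, hR.psi_eq]

theorem most_most (hS : S.Closed) (hR : R.Closed) (hU : IsUnifier N S R M U)
    (h : PreCE.rule N (.most S) (.most R) M = some (.ifThen (.most S) (.ifThen (.most R)
        (.most (.choice (.tuple S R M) (.choice S.toPre R.toPre)))))) :
    IsUnifier N (.most S) (.most R) M
      (.ifThen (.most S) (.ifThen (.most R) (.most (.choice U (.choice S R))))) where
  eval := .tuple h (.ifThen (.ifThen (.most (.choice hU.eval
    (.choice (PreCE.eval_toPre N S) (PreCE.eval_toPre N R))))))
  closedAt := ⟨hS.closedAt _, hR.closedAt _, hU.closedAt, hS.closedAt _, hR.closedAt _⟩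
  guarded _ _ _ _ := ⟨trivial, trivial, trivial⟩
  psi_eq t ht := by
    have hS1 : (most S).Closed := hS
    have hR1 : (most R).Closed := hR
    rw [psi, hS1.psi_eq, psi, hR1.psi_eq]
    by_cases hSf : Psi t (.most S) = fail
    · simp [hSf]
    by_cases hRf : Psi t (.most R) = fail
    · simp [hRf]
    rw [if_pos hSf, if_pos hRf, unify_of_ne hSf hRf]
    have e : ∀ T : CE L X, Psi t (.most T) = PosCE.jumps (Finset.Icc 1 (arity t))
        (fun i => ((child t i).map (T.psi fun _ _ => fail)).getD fail) none := fun T => by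
      simp [Psi, psi]
    have hout : ∀ (f : L.Term X → PosCE L X), ∀ i ∉ Finset.Icc 1 (arity t),
        ((child t i).map f).getD fail = fail := fun f i hi => by simp [child_eq_none hi]
    rw [e, e, mergeAll_jumps (hout _) (hout _), psi, Finset.union_self]
    refine jumps_congr fun i _ => ?_
    cases hc : child t i with
    | none => rfl
    | some c => exact psi_combine hS hR hU c (ht.child hc)

/-- In the general list rule the two conditions discard the case where a whole list fails.
Afterwards unification is a position-wise union, to which a jump present on one side contributes
unchanged. -/
theorem exists_jumps {I J : Finset ℕ} {S : {i : ℕ // i ∈ I} → CE L X}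
    {R : {i : ℕ // i ∈ J} → CE L X} {r r' : Option (Ctx L X)} (hS : (jumps I S r).Closed)
    (hR : (jumps J R r').Closed)
    (hU : ∀ i (hI : i ∈ I) (hJ : i ∈ J), ∃ U, IsUnifier N (S ⟨i, hI⟩) (R ⟨i, hJ⟩) M U)
    (h : PreCE.rule N (.jumps I S r) (.jumps J R r') M =
      some (PreCE.listRule I S r J R r' M)) :
    ∃ U, IsUnifier N (.jumps I S r) (.jumps J R r') M U := by
  choose U hU using hU
  have e : ∀ (I : Finset ℕ) (S : {i : ℕ // i ∈ I} → CE L X) (r : Option (Ctx L X)) t,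
      Psi t (.jumps I S r) = PosCE.jumps I (fun i => if h : i ∈ I then
        ((child t i).map fun c => Psi c (S ⟨i, h⟩)).getD fail else fail) r := fun I S r t => by
    simp only [Psi, psi]
  rw [PreCE.listRule] at h
  split_ifs at h with h1 h2
  · obtain ⟨rfl, rfl, hr, hr'⟩ := h1
    obtain ⟨τ, rfl⟩ := Option.isSome_iff_exists.1 hr
    obtain ⟨τ', rfl⟩ := Option.isSome_iff_exists.1 hr'
    refine ⟨.jumps ∅ (fun _ => .fail) (mergeOpt (some τ) (some τ')), .tuple h
      (.jumps fun _ => .fail), fun _ => trivial, fun _ _ _ _ => trivial, fun t _ => ?_⟩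
    -- An insertion at the root keeps either list from failing.
    rw [e, e, unify_of_ne (by simp [jumps_eq_fail]) (by simp [jumps_eq_fail]),
      mergeAll_jumps (by simp) (by simp), psi, Finset.union_self]
    exact jumps_congr (by simp)
  · obtain ⟨rfl, hI, hr, hr'⟩ := h2
    obtain ⟨a, rfl⟩ := Finset.card_eq_one.1 hI
    obtain rfl := Option.isNone_iff_eq_none.1 hr
    obtain rfl := Option.isNone_iff_eq_none.1 hr'
    refine ⟨.jumps {a} (fun i => U i i.2 i.2) none, .tuple h (.jumps fun i => (hU _ _ _).eval),
      fun i => (hU _ _ _).closedAt, fun _ _ _ _ => trivial, fun t ht => ?_⟩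
    rw [e, e, unify_jumps_singleton, psi]
    refine jumps_congr fun i hi => ?_
    simp only [dif_pos hi]
    cases hc : child t i with
    | none => simp
    | some c => exact (hU i hi hi).psi_eq c (ht.child hc)
  · refine ⟨.ifThen (.jumps I S r) (.ifThen (.jumps J R r') (.jumps (I ∪ J) (fun i =>
        if hI : i.1 ∈ I then
          if hJ : i.1 ∈ J then .choice (U i hI hJ) (.choice (S ⟨i, hI⟩) (R ⟨i, hJ⟩))
          else S ⟨i, hI⟩
        else R ⟨i, (Finset.mem_union.1 i.2).resolve_left hI⟩) (mergeOpt r r'))),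
      .tuple h (.ifThen (.ifThen (.jumps fun i => ?_))),
      ⟨hS.closedAt _, hR.closedAt _, fun i => ?_⟩,
      fun _ _ _ _ => ⟨trivial, trivial, trivial⟩, fun t ht => ?_⟩
    · split_ifs with hI hJ
      · exact .choice (hU i hI hJ).eval (.choice (PreCE.eval_toPre _ _) (PreCE.eval_toPre _ _))
      · exact PreCE.eval_toPre _ _
      · exact PreCE.eval_toPre _ _
    · dsimp only
      split_ifs with hI hJ
      · exact ⟨(hU i hI hJ).closedAt, closedAt_mono _ 0 _ (Nat.zero_le _) (hS _),
          closedAt_mono _ 0 _ (Nat.zero_le _) (hR _)⟩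
      · exact closedAt_mono _ 0 _ (Nat.zero_le _) (hS _)
      · exact closedAt_mono _ 0 _ (Nat.zero_le _) (hR _)
    · rw [psi, hS.psi_eq, psi, hR.psi_eq]
      by_cases hSf : Psi t (.jumps I S r) = fail
      · simp [hSf]
      by_cases hRf : Psi t (.jumps J R r') = fail
      · simp [hRf]
      rw [if_pos hSf, if_pos hRf, unify_of_ne hSf hRf, e, e,
        mergeAll_jumps (fun i hi => dif_neg hi) (fun i hi => dif_neg hi), psi]
      refine jumps_congr fun i hi => ?_
      simp only [dif_pos hi]
      cases hc : child t i with
      | none => simp [mergeAll_fail]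
      | some c =>
          simp only [Option.map_some, Option.getD_some]
          by_cases hI : i ∈ I <;> by_cases hJ : i ∈ J
          · simp only [dif_pos hI, dif_pos hJ]
            exact psi_combine (hS _) (hR _) (hU i hI hJ) c (ht.child hc)
          · simp only [dif_pos hI, dif_neg hJ, mergeAll_fail]
            exact Closed.psi_eq (hS _) _ _
          · simp only [dif_neg hI, dif_pos hJ, fail_mergeAll]
            exact Closed.psi_eq (hR _) _ _
          · exact absurd (Finset.mem_union.1 hi) (by simp [hI, hJ])

end IsUnifier

/-! ### Existence of unifiers and the final assembly. -/

open Classical in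
-- Lexicographic induction: `n` counts the pairs of `A ×ˢ B` not yet recorded, `m` is the total
-- size. Unfolding may increase `m` but records a new pair; every other rule that leaves tuples
-- keeps the memory and decreases `m`.
theorem exists_isUnifier_of_mem {N : ℕ} {A B : Finset (CE L X)}
    (hA : ∀ T ∈ A, ∀ T', Deriv N T T' → T' ∈ A) (hB : ∀ T ∈ B, ∀ T', Deriv N T T' → T' ∈ B)
    (n : ℕ) : ∀ (m : ℕ) (S R : CE L X) (M : List (CE L X × CE L X)),
    ((A ×ˢ B) \ M.toFinset).card = n → S.size + R.size = m → S ∈ A → R ∈ B →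
    S.Closed → R.Closed → S.IsMonotone → R.IsMonotone → ∃ U, IsUnifier N S R M U := by
  induction n using Nat.strong_induction_on with
  | _ n ihn =>
  intro m
  induction m using Nat.strong_induction_on with
  | _ m ihm =>
  intro S R M hn hm hSA hRB hS hR hS' hR'
  have left : ∀ S', Deriv N S S' → S'.size < S.size → ∃ U, IsUnifier N S' R M U :=
    fun S' hd hlt => ihm _ (by omega) S' R M hn rfl (hA _ hSA _ hd) hRB (hd.closed hS) hR
      (hd.isMonotone hS hS') hR'
  have right : ∀ R', Deriv N R R' → R'.size < R.size → ∃ U, IsUnifier N S R' M U :=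
    fun R' hd hlt => ihm _ (by omega) S R' M hn rfl hSA (hB _ hRB _ hd) hS (hd.closed hR)
      hS' (hd.isMonotone hR hR')
  have both : ∀ S' R', Deriv N S S' → Deriv N R R' → S'.size < S.size → R'.size < R.size →
      ∃ U, IsUnifier N S' R' M U :=
    fun S' R' hd hd' hlt hlt' => ihm _ (by omega) S' R' M hn rfl (hA _ hSA _ hd)
      (hB _ hRB _ hd') (hd.closed hS) (hd'.closed hR) (hd.isMonotone hS hS')
      (hd'.isMonotone hR hR')
  have card_lt : (S, R) ∉ M → ((A ×ˢ B) \ ((S, R) :: M).toFinset).card < n := fun hM => by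
    rw [← hn]
    refine Finset.card_lt_card (Finset.ssubset_iff_of_subset ?_ |>.2 ⟨(S, R), ?_, ?_⟩)
    · exact Finset.sdiff_subset_sdiff le_rfl (by simp)
    · simp [hSA, hRB, hM]
    · simp
  have unfold_left : ∀ S', Deriv N S S' → (S, R) ∉ M →
      ∃ U, IsUnifier N S' R ((S, R) :: M) U :=
    fun S' hd hM => ihn _ (card_lt hM) _ S' R _ rfl rfl (hA _ hSA _ hd) hRB (hd.closed hS) hR
      (hd.isMonotone hS hS') hR'
  have unfold_right : ∀ R', Deriv N R R' → (S, R) ∉ M →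
      ∃ U, IsUnifier N S R' ((S, R) :: M) U :=
    fun R' hd hM => ihn _ (card_lt hM) _ S R' _ rfl rfl hSA (hB _ hRB _ hd) hS (hd.closed hR)
      hS' (hd.isMonotone hR hR')
  clear ihn ihm card_lt
  -- The case split acts on the unfolded copy `hro`, while `hr` keeps the equation for `rule` in the
  -- form that the lemmas on rules expect.
  obtain ⟨o, hr⟩ : ∃ o, PreCE.rule N S R M = o := ⟨_, rfl⟩
  have hro := hr
  unfold PreCE.rule at hro
  split at hro <;> subst hro
  case h_1 => exact ⟨_, .fail_left hr fun t => by simp [Psi, psi]⟩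
  case h_2 => exact ⟨_, .fail_left hr fun t => by simp [Psi, psi]⟩
  case h_3 =>
    obtain ⟨U, hU⟩ := left _ .pattern (Nat.lt_succ_self _)
    exact ⟨_, hU.pattern_left hr⟩
  case h_4 =>
    obtain ⟨U, hU⟩ := right _ .pattern (Nat.lt_succ_self _)
    exact ⟨_, hU.pattern_right hr⟩
  case h_5 =>
    exact IsUnifier.exists_jumps hS hR (fun i hI hJ => both _ _ (.jumps ⟨i, hI⟩) (.jumps ⟨i, hJ⟩)
      (size_jumps_lt _ _ _) (size_jumps_lt _ _ _)) hr
  case h_6 =>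
    obtain ⟨U, hU⟩ := left _ .choice_left (by simp only [size]; omega)
    obtain ⟨U', hU'⟩ := left _ .choice_right (by simp only [size]; omega)
    exact ⟨_, hU.choice_left hU' hr⟩
  case h_7 =>
    obtain ⟨U, hU⟩ := right _ .choice_left (by simp only [size]; omega)
    obtain ⟨U', hU'⟩ := right _ .choice_right (by simp only [size]; omega)
    exact ⟨_, hU.choice_right hU' hr⟩
  case h_8 =>
    obtain ⟨U, hU⟩ := left _ .ifThen (Nat.lt_succ_self _)
    exact ⟨_, hU.ifThen_left hS.1 hr⟩
  case h_9 =>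
    obtain ⟨U, hU⟩ := right _ .ifThen (Nat.lt_succ_self _)
    exact ⟨_, hU.ifThen_right hR.1 hr⟩
  case h_10 =>
    obtain ⟨U, hU⟩ := both _ _ .most .most (by simp only [size]; omega) (by simp only [size]; omega)
    exact ⟨_, hU.most_most hS hR hr⟩
  case h_11 =>
    obtain ⟨U, hU⟩ := left _ .most_list (size_mostList_lt _ _)
    exact ⟨_, hU.mostList_left hr⟩
  case h_12 =>
    obtain ⟨U, hU⟩ := right _ .most_list (size_mostList_lt _ _)
    exact ⟨_, hU.mostList_right hr⟩
  case h_13 =>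
    split_ifs at hr with hM
    · exact ⟨_, .var_of_getElem? (List.getElem?_idxOf hM) hr⟩
    · obtain ⟨U, hU⟩ := unfold_left _ .mu hM
      exact ⟨_, hU.mu_left hS hS' hr⟩
  case h_14 =>
    split_ifs at hr with hM
    · exact ⟨_, .var_of_getElem? (List.getElem?_idxOf hM) hr⟩
    · obtain ⟨U, hU⟩ := unfold_right _ .mu hM
      exact ⟨_, hU.mu_right hR hR' hr⟩
  case h_15 =>
    -- Only a free variable as a component could leave a tuple without a rule, and closedness
    -- excludes it.
    exfalso
    cases S <;> first
      | exact absurd hS (Nat.not_lt_zero _)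
      | (cases R <;> first
          | exact absurd hR (Nat.not_lt_zero _)
          | (simp [PreCE.rule] at hr; done)
          | simp_all)

theorem exists_isUnifier (N : ℕ) {S R : CE L X} (hS : S.Closed) (hR : R.Closed)
    (hS' : S.IsMonotone) (hR' : R.IsMonotone) : ∃ U, IsUnifier N S R [] U := by
  obtain ⟨A, hSA, hA⟩ := exists_finset_deriv_closed N hS
  obtain ⟨B, hRB, hB⟩ := exists_finset_deriv_closed N hR
  exact exists_isUnifier_of_mem hA hB _ _ S R [] rfl rfl hSA hRB hS hR hS' hR'

theorem CE.unify_eq {N : ℕ} {S R U : CE L X} (h : PreCE.Eval N (.tuple S R []) U) :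
    CE.unify N S R = U := by
  have hex : ∃ U : CE L X, PreCE.IsNormalForm N (.tuple S R []) U.toPre :=
    ⟨U, (h.isNormalForm_iff _).2 rfl⟩
  rw [CE.unify, dif_pos hex]
  exact toPre_injective ((h.isNormalForm_iff _).1 hex.choose_spec)

end HCE

theorem mainTheorem2 {L : FirstOrder.Language.{u, v}} {X : Type w} (N : ℕ)
    (S R : HCE.CE L X) (hS : S.Closed) (hR : R.Closed)
    (hS' : S.IsMonotone) (hR' : R.IsMonotone) :
    (∃ U : HCE.CE L X, U.Closed ∧
      ∀ P, HCE.PreCE.IsNormalForm N (HCE.PreCE.tuple S R []) P ↔ P = U.toPre) ∧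
    ∀ t : L.Term X, HCE.ArityLE N t →
      HCE.CE.Psi t (HCE.CE.combine N S R) =
        (HCE.CE.Psi t S).combine (HCE.CE.Psi t R) := by
  obtain ⟨U, hU⟩ := HCE.exists_isUnifier N hS hR hS' hR'
  -- The initial memory is empty, so closedness at its length is plain closedness.
  refine ⟨⟨U, hU.closedAt, hU.eval.isNormalForm_iff⟩, fun t ht => ?_⟩
  have hU' : HCE.CE.Closed U := hU.closedAt
  rw [← HCE.PosCE.choice_unify_eq_combine, ← hU.psi_eq t ht, hU'.psi_eq, HCE.CE.combine,
    HCE.CE.unify_eq hU.eval, HCE.CE.Psi_choice, HCE.CE.Psi_choice]
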